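/- Let $V$ be a 5-dimensional real vector space (for instance the tangent space $T_p(M)$ of a 5-dimensional space-time) with a Lorentzian inner product $g$ of signature $(-++++)$, let $R_{ab}$ be a real symmetric two-tensor on $V$, and let $R^a{}_b$ be its mixed form, a linear operator on $V$. The Segre type of $R$ lists the dimensions of the blocks of the Jordan canonical form of $R^a{}_b$ over $\mathbb{C}$. The digits of blocks with equal eigenvalues are enclosed in round brackets, the letters $z,\bar z$ replace the digits of the blocks with non-real eigenvalues, and if a real eigenvalue has a time-like eigenvector, the corresponding digit is separated by a comma from the others. A semi-null pentad is a basis $\{l,m,x,y,z\}$ of $V$ whose only non-vanishing inner products are $l^am_a=x^ax_a=y^ay_a=z^az_a=1$. A degeneracy of a Segre type arises from it when two or more of the distinct real eigenvalues become equal. Every such $R$ has exactly one Segre type, and this is, for exactly one of the four types $[1,1111]$, $[2111]$, $[311]$, $[z\bar z111]$, that type or one of its degeneracies. Altogether there are exactly twenty-two degeneracies, and all four types and all the degeneracies occur. Moreover, $R$ has one of the four types, or a given degeneracy of it, if and only if there is a semi-null pentad with respect to which $R$ takes the corresponding canonical form $$[1,1111]:\quad R_{ab}=2\rho_1\,l_{(a}m_{b)}+\rho_2\,(l_al_b+m_am_b)+\rho_3\,x_ax_b+\rho_4\,y_ay_b+\rho_5\,z_az_b,$$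 $$[2111]:\quad R_{ab}=2\rho_1\,l_{(a}m_{b)}\pm l_al_b+\rho_3\,x_ax_b+\rho_4\,y_ay_b+\rho_5\,z_az_b,$$ $$[311]:\quad R_{ab}=2\rho_1\,l_{(a}m_{b)}+2\,l_{(a}x_{b)}+\rho_1\,x_ax_b+\rho_4\,y_ay_b+\rho_5\,z_az_b,$$ $$[z\bar z111]:\quad R_{ab}=2\rho_1\,l_{(a}m_{b)}+\rho_2\,(l_al_b-m_am_b)+\rho_3\,x_ax_b+\rho_4\,y_ay_b+\rho_5\,z_az_b,\qquad \rho_2\neq0,$$ with real $\rho_1,\dots,\rho_5$ for which exactly those eigenvalues coincide that the round brackets of the Segre type indicate. Here the eigenvalues belonging to the digits (or letters) of the type are, in order, $\rho_1-\rho_2$ (time-like), $\rho_1+\rho_2,\rho_3,\rho_4,\rho_5$ for $[1,1111]$; $\rho_1,\rho_3,\rho_4,\rho_5$ for $[2111]$; $\rho_1,\rho_4,\rho_5$ for $[311]$; and $\rho_1+ i\rho_2,\rho_1- i\rho_2$ (in one order or the other), $\rho_3,\rho_4,\rho_5$ for $[z\bar z111]$. -/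

import Mathlib

open scoped TensorProduct

namespace Segre5D

noncomputable section

/-! ### Lorentzian spaces, semi-null pentads, mixed tensors -/

section Lorentz

variable {V : Type*} [AddCommGroup V] [Module ℝ V]

/-- `g` is a Lorentzian inner product of signature `(- + + + +)` on the five-dimensional real vector
space `V`: there is a Lorentz pentad, i.e. a basis `t, w, x, y, z` whose only non-zero inner
products are `-t·t = w·w = x·x = y·y = z·z = 1`. -/
def IsLorentzian (g : LinearMap.BilinForm ℝ V) : Prop :=
  ∃ b : Module.Basis (Fin 5) ℝ V,
    ∀ i j, g (b i) (b j) = if i = j then (if i = 0 then -1 else 1) else 0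

theorem IsLorentzian.nondegenerate {g : LinearMap.BilinForm ℝ V} (hg : IsLorentzian g) :
    g.Nondegenerate := by
  obtain ⟨b, hb⟩ := hg
  have hm : LinearMap.BilinForm.toMatrix b g
      = Matrix.diagonal (fun i : Fin 5 => if i = 0 then (-1 : ℝ) else 1) := by
    ext i j
    rw [LinearMap.BilinForm.toMatrix_apply, hb, Matrix.diagonal_apply]
  refine LinearMap.BilinForm.nondegenerate_of_det_ne_zero g b ?_
  rw [hm, Matrix.det_diagonal, Finset.prod_ne_zero_iff]
  intro i _
  split_ifs <;> norm_num

/-- A semi-null pentad: a basis `l, m, x, y, z` of `V` whose only non-zero inner products are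
`l·m = m·l = x·x = y·y = z·z = 1`. -/
structure SemiNullPentad (g : LinearMap.BilinForm ℝ V) where
  basis : Module.Basis (Fin 5) ℝ V
  inner_eq : ∀ i j, g (basis i) (basis j) =
    (!![0, 1, 0, 0, 0;
        1, 0, 0, 0, 0;
        0, 0, 1, 0, 0;
        0, 0, 0, 1, 0;
        0, 0, 0, 0, 1] : Matrix (Fin 5) (Fin 5) ℝ) i j

namespace SemiNullPentad

variable {g : LinearMap.BilinForm ℝ V} (P : SemiNullPentad g)

def l : V := P.basis 0
def m : V := P.basis 1
def x : V := P.basis 2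
def y : V := P.basis 3
def z : V := P.basis 4

end SemiNullPentad

/-- The two-tensor `a_a b_b`, where `a_a = g_{ac} a^c` and `b_b = g_{bc} b^c`. -/
def prod (g : LinearMap.BilinForm ℝ V) (a b : V) : LinearMap.BilinForm ℝ V :=
  LinearMap.BilinForm.linMulLin (g a) (g b)

/-- The two-tensor `2 a_(a b_b) = a_a b_b + b_a a_b`. -/
def symProd (g : LinearMap.BilinForm ℝ V) (a b : V) : LinearMap.BilinForm ℝ V :=
  prod g a b + prod g b a

/-- The mixed form `R^a_b` of a two-tensor `R_ab`: the linear operator `T` on `V` which is determined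
by `g (T v) w = R v w`. -/
def mixed (g : LinearMap.BilinForm ℝ V) (hg : IsLorentzian g) (R : LinearMap.BilinForm ℝ V)
    [FiniteDimensional ℝ V] : V →ₗ[ℝ] V :=
  R.symmCompOfNondegenerate g hg.nondegenerate

end Lorentz

/-! ### Segre symbols -/

/-- The kind of an eigenvalue: a non-real eigenvalue with positive (`z`) or negative (`zbar`)
imaginary part, a real eigenvalue that has a time-like eigenvector (`timelike`), or any other real
eigenvalue (`real`). -/
inductive EigenvalueKind
  | real
  | timelike
  | z
  | zbar

/-- The part of a Segre symbol that belongs to one eigenvalue: the kind of the eigenvalue and the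
dimensions of its Jordan blocks. Thus `⟨real, {2, 1}⟩` is written `(21)`; `⟨timelike, {1, 1, 1}⟩`
is written `(1,11)`, the comma separating the digit of a time-like eigenvector from the others;
`⟨z, {1}⟩` and `⟨zbar, {1}⟩` are written with the letters `z` and `z̄`. -/
structure SegreGroup where
  kind : EigenvalueKind
  blocks : Multiset ℕ

/-- A Segre symbol: the collection of the groups of all the distinct eigenvalues, in which neither
the values of the eigenvalues nor their order are recorded. -/
abbrev SegreSymbol := Multiset SegreGroup

open scoped Classical in
/-- The kind of the eigenvalue `c`, where `τ` singles out the real eigenvalues that have a time-like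
eigenvector. -/
def eigenvalueKind (τ : ℝ → Prop) (c : ℂ) : EigenvalueKind :=
  if 0 < c.im then .z
  else if c.im < 0 then .zbar
  else if τ c.re then .timelike
  else .real

open scoped Classical in
/-- The Segre symbol of a list of Jordan blocks with dimensions `r i` and eigenvalues `μ i`: the
dimensions of the blocks with equal eigenvalues are collected in one group. -/
def symbolOf {n : ℕ} (r : Fin n → ℕ) (μ : Fin n → ℂ) (τ : ℝ → Prop) : SegreSymbol :=
  (Finset.univ.image μ).val.map fun c =>
    ⟨eigenvalueKind τ c, (Finset.univ.filter fun i => μ i = c).val.map r⟩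

/-- The Jordan block `J_r(c)`. -/
def jordanBlock (r : ℕ) (c : ℂ) : Matrix (Fin r) (Fin r) ℂ :=
  Matrix.of fun i j => if i = j then c else if (i : ℕ) + 1 = j then 1 else 0

/-- The symmetric two-tensor `R` has the Segre type `s`: the complexification of its mixed form has,
in some basis, a Jordan canonical form whose blocks give the symbol `s`. -/
def HasSegreType {V : Type*} [AddCommGroup V] [Module ℝ V] [FiniteDimensional ℝ V]
    (g : LinearMap.BilinForm ℝ V) (hg : IsLorentzian g) (R : LinearMap.BilinForm ℝ V)
    (s : SegreSymbol) : Prop :=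
  ∃ (n : ℕ) (r : Fin n → ℕ) (μ : Fin n → ℂ)
    (e : Module.Basis (Σ i : Fin n, Fin (r i)) ℂ (ℂ ⊗[ℝ] V)),
    (∀ i, 0 < r i) ∧
    LinearMap.toMatrix e e ((mixed g hg R).baseChange ℂ)
      = Matrix.blockDiagonal' (fun i => jordanBlock (r i) (μ i)) ∧
    s = symbolOf r μ (fun c => ∃ v : V, g v v < 0 ∧ mixed g hg R v = c • v)

/-! ### The four types and their degeneracies -/

/-- The four non-degenerate types `[1,1111]`, `[2111]`, `[311]` and `[z z̄ 111]`. -/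
inductive SegreClass
  | type11111
  | type2111
  | type311
  | typeZZ111

/-- The Segre symbol of each of the four types: all the eigenvalues are distinct. -/
def SegreClass.symbol : SegreClass → SegreSymbol
  | .type11111 => {⟨.timelike, {1}⟩, ⟨.real, {1}⟩, ⟨.real, {1}⟩, ⟨.real, {1}⟩, ⟨.real, {1}⟩}
  | .type2111 => {⟨.real, {2}⟩, ⟨.real, {1}⟩, ⟨.real, {1}⟩, ⟨.real, {1}⟩}
  | .type311 => {⟨.real, {3}⟩, ⟨.real, {1}⟩, ⟨.real, {1}⟩}
  | .typeZZ111 => {⟨.z, {1}⟩, ⟨.zbar, {1}⟩, ⟨.real, {1}⟩, ⟨.real, {1}⟩, ⟨.real, {1}⟩}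

/-- `s'` arises from `s` by letting two distinct real eigenvalues become equal: the digits of two
groups are enclosed in one pair of round brackets (at most one of the two groups being that of the
time-like eigenvector, in which case the resulting group is, too). -/
def Brackets (s s' : SegreSymbol) : Prop :=
  ∃ (a b : SegreGroup) (t : Multiset SegreGroup),
    (a.kind = .real ∨ a.kind = .timelike) ∧ b.kind = .real ∧
    s = a ::ₘ b ::ₘ t ∧ s' = ⟨a.kind, a.blocks + b.blocks⟩ ::ₘ t

/-- `s` is a (proper) degeneracy of the type `F`. -/
def SegreClass.IsDegeneracy (F : SegreClass) (s : SegreSymbol) : Prop :=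
  Relation.TransGen Brackets F.symbol s

/-- `R` has, with respect to some semi-null pentad, the canonical form of the type `F`, and the
coincidences between the eigenvalues `ρ₁ ± ρ₂` (or `ρ₁`, or `ρ₁ ± i ρ₂`), `ρ₃`, `ρ₄`, `ρ₅` of that
form are those indicated by the brackets of the Segre symbol `s`. -/
def HasCanonicalForm {V : Type*} [AddCommGroup V] [Module ℝ V]
    (g R : LinearMap.BilinForm ℝ V) (s : SegreSymbol) : SegreClass → Prop
  | .type11111 => ∃ (P : SemiNullPentad g) (ρ₁ ρ₂ ρ₃ ρ₄ ρ₅ : ℝ),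
      R = ρ₁ • symProd g P.l P.m + ρ₂ • (prod g P.l P.l + prod g P.m P.m)
        + ρ₃ • prod g P.x P.x + ρ₄ • prod g P.y P.y + ρ₅ • prod g P.z P.z ∧
      s = symbolOf ![1, 1, 1, 1, 1] ![(ρ₁ : ℂ) - ρ₂, (ρ₁ : ℂ) + ρ₂, ρ₃, ρ₄, ρ₅]
        (fun c => c = ρ₁ - ρ₂)
  | .type2111 => ∃ (P : SemiNullPentad g) (ε ρ₁ ρ₃ ρ₄ ρ₅ : ℝ), (ε = 1 ∨ ε = -1) ∧
      R = ρ₁ • symProd g P.l P.m + ε • prod g P.l P.l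
        + ρ₃ • prod g P.x P.x + ρ₄ • prod g P.y P.y + ρ₅ • prod g P.z P.z ∧
      s = symbolOf ![2, 1, 1, 1] ![(ρ₁ : ℂ), ρ₃, ρ₄, ρ₅] (fun _ => False)
  | .type311 => ∃ (P : SemiNullPentad g) (ρ₁ ρ₄ ρ₅ : ℝ),
      R = ρ₁ • symProd g P.l P.m + symProd g P.l P.x
        + ρ₁ • prod g P.x P.x + ρ₄ • prod g P.y P.y + ρ₅ • prod g P.z P.z ∧
      s = symbolOf ![3, 1, 1] ![(ρ₁ : ℂ), ρ₄, ρ₅] (fun _ => False)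
  | .typeZZ111 => ∃ (P : SemiNullPentad g) (ρ₁ ρ₂ ρ₃ ρ₄ ρ₅ : ℝ), ρ₂ ≠ 0 ∧
      R = ρ₁ • symProd g P.l P.m + ρ₂ • (prod g P.l P.l - prod g P.m P.m)
        + ρ₃ • prod g P.x P.x + ρ₄ • prod g P.y P.y + ρ₅ • prod g P.z P.z ∧
      s = symbolOf ![1, 1, 1, 1, 1]
        ![(ρ₁ : ℂ) + ρ₂ * Complex.I, (ρ₁ : ℂ) - ρ₂ * Complex.I, ρ₃, ρ₄, ρ₅] (fun _ => False)

end

end Segre5D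

/-! The mixed form $T$ of $R$ is self-adjoint for $g$, and the classification comes from finding a
small invariant subspace that contains the time direction. The orthogonal complement of such a
subspace is Euclidean, so the spectral theorem supplies the remaining pentad vectors.

Splitting off space-like eigenvectors one at a time leaves a time-like eigenvector, a null
eigenvector, or a pair of conjugate non-real eigenvalues
(`exists_nonspacelike_eigenvector_or_complex_pair`). The first and third cases give an invariant
Lorentzian plane. For a null eigenvector $l$ with eigenvalue $a$ put $N=T-a$. If $l=N^2m$, there is
a chain of length three, and the type is $[311]$. Otherwise $\operatorname{im}N^2=(\ker N^2)^\perp$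
yields $p\in\ker N^2$ with $g(l,p)\ne0$, and $l,p$ span an invariant Lorentzian plane. In a null
basis of an invariant plane, $Tl=al+bm$ and $Tm=cl+am$; rescaling the basis leaves only the
vanishing and the relative sign of $b,c$, which separate $[1,1111]$, $[2111]$ and $[z\bar z111]$.

Each canonical form displays its own Jordan basis over $\mathbb{C}$, and its time-like eigenvectors
can be read off (`HasCanonicalForm.hasSegreType`). Jordan blocks are determined by the dimensions of
$\ker(T-c)^k$, so the type is unique (`HasSegreType.unique`).

What remains is combinatorics. The symbols realised by eigenvalue lists of a given form are exactly
those reached from the generic symbol by merging real groups (`SegreClass.attains_iff`). The block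
dimensions and the number of letters $z$ survive merging and tell the four families apart; the
twenty-two degeneracies are counted by computation. -/

namespace Segre5D

/-! ### Causal geometry and the spectral theorem on Euclidean subspaces -/

section LorentzGeometry

variable {V : Type*} [AddCommGroup V] [Module ℝ V] {g : LinearMap.BilinForm ℝ V}

theorem IsLorentzian.symm (hg : IsLorentzian g) (u v : V) : g u v = g v u := by
  obtain ⟨b, hb⟩ := hg
  have : g = g.flip := by
    refine LinearMap.BilinForm.ext_basis b fun i j => ?_
    rw [LinearMap.BilinForm.flip_apply, hb, hb]
    by_cases h : i = j
    · subst h; rfl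
    · rw [if_neg h, if_neg (Ne.symm h)]
  conv_lhs => rw [this]
  rfl

theorem IsLorentzian.finrank_eq (hg : IsLorentzian g) : Module.finrank ℝ V = 5 := by
  obtain ⟨b, -⟩ := hg
  simp [Module.finrank_eq_card_basis b]

/-- A Lorentzian inner product is positive definite on some hyperplane. -/
theorem IsLorentzian.exists_posDef_hyperplane (hg : IsLorentzian g) :
    ∃ φ : V →ₗ[ℝ] ℝ, ∀ w, φ w = 0 → w ≠ 0 → 0 < g w w := by
  obtain ⟨b, hb⟩ := hg
  refine ⟨b.coord 0, fun w hw hne => ?_⟩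
  have h1 : g w w = ∑ i, (if i = 0 then -1 else 1) * b.repr w i ^ 2 := by
    have h : ∀ u, g u u = ∑ i, ∑ j, b.repr u i * b.repr u j * g (b i) (b j) := fun u => by
      conv_lhs => rw [← b.sum_repr u]
      simp only [map_sum, LinearMap.sum_apply, map_smul, LinearMap.smul_apply, smul_eq_mul,
        Finset.mul_sum]
      rw [Finset.sum_comm]
      exact Finset.sum_congr rfl fun i _ => Finset.sum_congr rfl fun j _ => by ring
    rw [h]
    refine Finset.sum_congr rfl fun i _ => ?_
    rw [Finset.sum_eq_single i (fun j _ hj => by rw [hb, if_neg hj.symm, mul_zero]) (by simp), hb,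
      if_pos rfl]
    ring
  have h0 : b.repr w 0 = 0 := hw
  have hle : ∀ i, 0 ≤ (if i = 0 then (-1 : ℝ) else 1) * b.repr w i ^ 2 := by
    intro i
    split_ifs with h
    · subst h; simp [h0]
    · positivity
  rw [h1]
  refine lt_of_le_of_ne (Finset.sum_nonneg fun i _ => hle i) fun h => hne ?_
  have h2 := (Finset.sum_eq_zero_iff_of_nonneg fun i _ => hle i).1 h.symm
  apply b.repr.map_eq_zero_iff.1
  ext i
  have := h2 i (Finset.mem_univ i)
  by_cases hi : i = 0
  · subst hi; simpa using h0
  · simpa [hi] using this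

/-- A vector orthogonal to a non-zero vector that is not space-like is space-like or proportional
to it. -/
theorem IsLorentzian.nonneg_of_orthogonal (hg : IsLorentzian g) {u v : V} (hu : u ≠ 0)
    (huu : g u u ≤ 0) (huv : g u v = 0) : 0 ≤ g v v ∧ (g v v = 0 → ∃ κ : ℝ, v = κ • u) := by
  obtain ⟨φ, hφ⟩ := hg.exists_posDef_hyperplane
  have hφu : φ u ≠ 0 := fun h => absurd (hφ u h hu) (not_lt.2 huu)
  -- This $\kappa$ puts $v-\kappa u$ in the positive definite hyperplane; since $g(u,v)=0$, its
  -- square is $g(v,v)+\kappa^2g(u,u)\le g(v,v)$.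
  set κ := φ v / φ u with hκ
  have hw0 : φ (v - κ • u) = 0 := by
    simp [hκ, div_mul_cancel₀ _ hφu]
  have hww : g (v - κ • u) (v - κ • u) = g v v + κ ^ 2 * g u u := by
    have := hg.symm u v
    simp only [map_sub, LinearMap.sub_apply, map_smul, LinearMap.smul_apply, smul_eq_mul]
    rw [← this, huv]; ring
  have hk : κ ^ 2 * g u u ≤ 0 := mul_nonpos_of_nonneg_of_nonpos (sq_nonneg _) huu
  have hdef : v - κ • u = 0 ∨ 0 < g (v - κ • u) (v - κ • u) := by
    by_cases h : v - κ • u = 0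
    · exact Or.inl h
    · exact Or.inr (hφ _ hw0 h)
  constructor
  · rcases hdef with h | h
    · rw [h] at hww; simp at hww; linarith
    · linarith
  · intro h
    rcases hdef with h' | h'
    · exact ⟨κ, sub_eq_zero.1 h'⟩
    · linarith

/-- Orthogonality to the null vector `l` leaves only space-like vectors and multiples of `l`;
orthogonality to `m` excludes the non-zero multiples. This makes the complement of a null pair
Euclidean. -/
theorem IsLorentzian.pos_of_orthogonal_null_pair (hg : IsLorentzian g) {l m v : V}
    (hll : g l l = 0) (hlm : g l m = 1) (hlv : g l v = 0) (hmv : g m v = 0) (hv : v ≠ 0) :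
    0 < g v v := by
  have hl : l ≠ 0 := by rintro rfl; simp at hlm
  obtain ⟨h1, h2⟩ := hg.nonneg_of_orthogonal hl hll.le hlv
  refine lt_of_le_of_ne h1 fun h => ?_
  obtain ⟨κ, rfl⟩ := h2 h.symm
  rw [map_smul, hg.symm m l, hlm] at hmv
  simp at hmv
  simp [hmv] at hv

/-- A self-adjoint operator has an orthonormal eigenbasis on an invariant subspace on which the
inner product is positive definite. -/
theorem exists_orthonormal_eigenvectors [FiniteDimensional ℝ V] (hs : ∀ u v, g u v = g v u)
    {T : V →ₗ[ℝ] V} (hT : ∀ u v, g (T u) v = g u (T v)) (W : Submodule ℝ V)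
    (hW : ∀ w ∈ W, T w ∈ W) (hpos : ∀ w ∈ W, w ≠ 0 → 0 < g w w) {k : ℕ}
    (hk : Module.finrank ℝ W = k) :
    ∃ (e : Fin k → V) (c : Fin k → ℝ), (∀ i, e i ∈ W) ∧
      (∀ i j, g (e i) (e j) = if i = j then 1 else 0) ∧ ∀ i, T (e i) = c i • e i := by
  let core : InnerProductSpace.Core ℝ W :=
    { inner := fun u v => g u v
      conj_inner_symm := fun u v => by simpa using hs v u
      re_inner_nonneg := fun u => by
        by_cases h : u = 0
        · simp [h]
        · simpa using (hpos u u.2 (by simpa using h)).le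
      add_left := fun u v w => by simp
      smul_left := fun u v r => by simp
      definite := fun u hu => by
        by_contra h
        exact (hpos u u.2 (by simpa using h)).ne' hu }
  let : NormedAddCommGroup W := core.toNormedAddCommGroup
  let : InnerProductSpace ℝ W := InnerProductSpace.ofCore core.toCore
  have hinner : ∀ u v : W, inner ℝ u v = g u v := fun u v => rfl
  have hsym : (T.restrict hW).IsSymmetric := fun u v => by
    rw [hinner, hinner]; exact hT u v
  let b := hsym.eigenvectorBasis hk
  refine ⟨fun i => b i, fun i => hsym.eigenvalues hk i, fun i => (b i).2, fun i j => ?_,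
    fun i => ?_⟩
  · have := orthonormal_iff_ite.1 b.orthonormal i j
    rwa [hinner] at this
  · have := hsym.apply_eigenvectorBasis hk i
    exact congrArg Subtype.val this

end LorentzGeometry

/-! ### Eigenvectors that are not space-like, and complex pairs -/

section Eigenvectors

/-- An operator on a non-trivial real space has an eigenvector or a pair of vectors that are the real
and imaginary parts of an eigenvector of the complexification. -/
theorem exists_eigenvector_or_complex_pair {E : Type*} [AddCommGroup E] [Module ℝ E]
    [FiniteDimensional ℝ E] [Nontrivial E] (T : E →ₗ[ℝ] E) :
    ∃ v : E, v ≠ 0 ∧ ((∃ c : ℝ, T v = c • v) ∨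
      ∃ (u : E) (α β : ℝ), β ≠ 0 ∧ T v = α • v - β • u ∧ T u = β • v + α • u) := by
  have hint : IsIntegral ℝ T := Algebra.IsIntegral.isIntegral T
  -- A non-constant factor `q` of the minimal polynomial annihilates a non-zero vector: by
  -- minimality the cofactor `r` does not vanish at `T`, and `q` kills the range of `r(T)`.
  have key : ∀ q : Polynomial ℝ, q ∣ minpoly ℝ T → 0 < q.degree →
      ∃ v : E, v ≠ 0 ∧ Polynomial.aeval T q v = 0 := by
    rintro q ⟨r, hr⟩ hq
    have hm := minpoly.ne_zero hint
    have hr0 : r ≠ 0 := by rintro rfl; simp at hr; exact hm hr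
    have hrT : Polynomial.aeval T r ≠ 0 := by
      intro h
      have h1 := minpoly.degree_le_of_ne_zero ℝ T hr0 h
      rw [hr, Polynomial.degree_mul, Polynomial.degree_eq_natDegree hr0] at h1
      have hq0 : q ≠ 0 := by rintro rfl; simp at hq
      rw [Polynomial.degree_eq_natDegree hq0] at h1 hq
      norm_cast at h1 hq
      omega
    obtain ⟨x, hx⟩ : ∃ x, Polynomial.aeval T r x ≠ 0 := by
      by_contra! h
      exact hrT (LinearMap.ext h)
    refine ⟨_, hx, ?_⟩
    rw [← Module.End.mul_apply, ← map_mul, ← hr, minpoly.aeval]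
    rfl
  obtain ⟨z, hz⟩ := IsAlgClosed.exists_aeval_eq_zero ℂ (minpoly ℝ T) (minpoly.degree_pos hint).ne'
  by_cases him : z.im = 0
  · have hre : Polynomial.aeval z.re (minpoly ℝ T) = 0 := by
      have : z = algebraMap ℝ ℂ z.re := Complex.ext (by simp) (by simp [him])
      rw [this, Polynomial.aeval_algebraMap_apply] at hz
      simpa using hz
    obtain ⟨v, hv, hv0⟩ := key (Polynomial.X - Polynomial.C z.re)
      (Polynomial.dvd_iff_isRoot.2 (by simpa using hre)) (by simp)
    refine ⟨v, hv, Or.inl ⟨z.re, ?_⟩⟩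
    simpa [sub_eq_zero] using hv0
  · obtain ⟨v, hv, hv0⟩ := key _ (Polynomial.quadratic_dvd_of_aeval_eq_zero_im_ne_zero _ hz him)
      (by
        have : (Polynomial.X ^ 2 - Polynomial.C (2 * z.re) * Polynomial.X
          + Polynomial.C (‖z‖ ^ 2) : Polynomial ℝ).degree = 2 := by compute_degree!
        rw [this]; norm_num)
    -- The vector `u` is forced by $Tv=\alpha v-\beta u$; the quadratic relation for $T$ on $v$ then
    -- gives the formula for $Tu$.
    refine ⟨v, hv, Or.inr ⟨z.im⁻¹ • (z.re • v - T v), z.re, z.im, him, ?_, ?_⟩⟩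
    · rw [smul_smul, mul_inv_cancel₀ him]; module
    · have hn : ‖z‖ ^ 2 = z.re ^ 2 + z.im ^ 2 := by
        rw [← Complex.normSq_eq_norm_sq, Complex.normSq_apply]; ring
      have h2 : T (T v) = (2 * z.re) • T v - (z.re ^ 2 + z.im ^ 2) • v := by
        have : T (T v) - (2 * z.re) • T v + (z.re ^ 2 + z.im ^ 2) • v = 0 := by
          rw [← hn, ← hv0]
          simp [pow_two, Module.algebraMap_end_apply, mul_smul, smul_comm z.re]
        rw [← sub_eq_zero, ← this]; module
      rw [map_smul, map_sub, map_smul, h2]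
      apply smul_right_injective E him
      simp only [smul_add, smul_smul, mul_inv_cancel₀ him]
      match_scalars <;> field_simp <;> ring

/-- An operator that is self-adjoint for an inner product that is not positive definite has a
non-space-like eigenvector or a complex pair. -/
theorem exists_nonspacelike_eigenvector_or_complex_pair {V : Type*} [AddCommGroup V] [Module ℝ V]
    [FiniteDimensional ℝ V] {g : LinearMap.BilinForm ℝ V} (hs : ∀ u v, g u v = g v u)
    {T : V →ₗ[ℝ] V} (hT : ∀ u v, g (T u) v = g u (T v)) (n : ℕ) :
    ∀ W : Submodule ℝ V, Module.finrank ℝ W = n → (∀ w ∈ W, T w ∈ W) →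
      (∃ w ∈ W, w ≠ 0 ∧ g w w ≤ 0) →
      ∃ v : V, v ≠ 0 ∧ ((g v v ≤ 0 ∧ ∃ c : ℝ, T v = c • v) ∨
        ∃ (u : V) (α β : ℝ), β ≠ 0 ∧ T v = α • v - β • u ∧ T u = β • v + α • u) := by
  induction n using Nat.strong_induction_on with
  | _ n ih =>
  intro W hn hW hw
  obtain ⟨w, hwW, hw0, hww⟩ := hw
  have : Nontrivial W := ⟨⟨⟨w, hwW⟩, 0, fun h => hw0 (congrArg Subtype.val h)⟩⟩
  obtain ⟨v, hv, ⟨c, hc⟩ | ⟨u, α, β, hβ, h1, h2⟩⟩ :=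
    exists_eigenvector_or_complex_pair (T.restrict hW)
  · have hv0 : (v : V) ≠ 0 := by simpa using hv
    have hTv : T v = c • (v : V) := congrArg Subtype.val hc
    by_cases hvv : g (v : V) v ≤ 0
    · exact ⟨v, hv0, Or.inl ⟨hvv, c, hTv⟩⟩
    push Not at hvv
    -- The complement in `W` of a space-like eigenvector is invariant and smaller. It still contains
    -- a non-zero vector that is not space-like, because removing the component of `w` along `v`
    -- only lowers $g(w,w)$.
    let W' : Submodule ℝ V := W ⊓ LinearMap.ker (g v)
    have hlt : W' < W := by
      refine lt_of_le_of_ne inf_le_left fun h => ?_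
      have hv' : (v : V) ∈ W ⊓ LinearMap.ker (g v) := h.ge v.2
      exact hvv.ne' hv'.2
    refine ih _ (hn ▸ Submodule.finrank_lt_finrank_of_lt hlt) W' rfl ?_ ?_
    · rintro x ⟨hx1, hx2⟩
      refine ⟨hW x hx1, ?_⟩
      change g v x = 0 at hx2
      change g v (T x) = 0
      rw [← hT, hTv, map_smul, LinearMap.smul_apply, hx2, smul_zero]
    · obtain ⟨κ, hκdef⟩ : ∃ κ : ℝ, κ = g (v : V) w / g (v : V) v := ⟨_, rfl⟩
      have hgw : g v (w - κ • (v : V)) = 0 := by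
        simp [hκdef, div_mul_cancel₀ _ hvv.ne']
      refine ⟨w - κ • (v : V), ⟨W.sub_mem hwW (W.smul_mem _ v.2), hgw⟩, ?_, ?_⟩
      · intro h
        rw [sub_eq_zero] at h
        have : g w w = κ ^ 2 * g (v : V) v := by
          rw [h]; simp; ring
        have hκ : κ ≠ 0 := by
          rintro h0; rw [h0, zero_smul] at h; exact hw0 h
        have := mul_pos (pow_pos (abs_pos.2 hκ) 2) hvv
        rw [sq_abs] at this
        linarith
      · have : g (w - κ • (v : V)) (w - κ • (v : V)) = g w w - κ ^ 2 * g (v : V) v := by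
          have h3 : g w (v : V) = κ * g (v : V) v := by
            rw [hs]; simp [hκdef, div_mul_cancel₀ _ hvv.ne']
          have h4 : g (v : V) w = κ * g (v : V) v := by rw [← h3, hs]
          simp only [map_sub, LinearMap.sub_apply, map_smul, LinearMap.smul_apply, smul_eq_mul,
            h3, h4]
          ring
        rw [this]
        have := mul_nonneg (sq_nonneg κ) hvv.le
        linarith
  · refine ⟨v, by simpa using hv, Or.inr ⟨u, α, β, hβ, ?_, ?_⟩⟩
    · exact congrArg Subtype.val h1
    · exact congrArg Subtype.val h2

end Eigenvectors

/-! ### The mixed form as a self-adjoint operator -/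

section MixedForm

variable {V : Type*} [AddCommGroup V] [Module ℝ V] {g : LinearMap.BilinForm ℝ V}

theorem IsLorentzian.eq_of_forall_apply_eq (hg : IsLorentzian g) {a b : V}
    (h : ∀ v, g a v = g b v) : a = b := by
  have h0 : ∀ v, g (a - b) v = 0 := fun v => by rw [map_sub, LinearMap.sub_apply, h, sub_self]
  exact sub_eq_zero.1 (hg.nondegenerate.1 _ h0)

variable [FiniteDimensional ℝ V] (hg : IsLorentzian g)

theorem apply_mixed (R : LinearMap.BilinForm ℝ V) (u v : V) : g (mixed g hg R u) v = R u v :=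
  LinearMap.BilinForm.symmCompOfNondegenerate_left_apply _ _ _ _

theorem mixed_add (R R' : LinearMap.BilinForm ℝ V) (u : V) :
    mixed g hg (R + R') u = mixed g hg R u + mixed g hg R' u :=
  hg.eq_of_forall_apply_eq fun v => by simp [apply_mixed]

theorem mixed_sub (R R' : LinearMap.BilinForm ℝ V) (u : V) :
    mixed g hg (R - R') u = mixed g hg R u - mixed g hg R' u :=
  hg.eq_of_forall_apply_eq fun v => by simp [apply_mixed]

theorem mixed_smul (c : ℝ) (R : LinearMap.BilinForm ℝ V) (u : V) :
    mixed g hg (c • R) u = c • mixed g hg R u :=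
  hg.eq_of_forall_apply_eq fun v => by simp [apply_mixed]

theorem mixed_prod (a b u : V) : mixed g hg (prod g a b) u = g a u • b :=
  hg.eq_of_forall_apply_eq fun v => by simp [apply_mixed, prod]

theorem mixed_symProd (a b u : V) : mixed g hg (symProd g a b) u = g a u • b + g b u • a := by
  rw [symProd, mixed_add, mixed_prod, mixed_prod]

theorem eq_of_mixed_basis_eq {ι : Type*} (b : Module.Basis ι ℝ V) {R R' : LinearMap.BilinForm ℝ V}
    (h : ∀ i, mixed g hg R (b i) = mixed g hg R' (b i)) : R = R' := by
  have h1 : mixed g hg R = mixed g hg R' := b.ext h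
  ext u v
  rw [← apply_mixed hg R, ← apply_mixed hg R', h1]

theorem mixed_selfAdjoint {R : LinearMap.BilinForm ℝ V} (hR : R.IsSymm) (u v : V) :
    g (mixed g hg R u) v = g u (mixed g hg R v) := by
  rw [apply_mixed, hg.symm, apply_mixed, hR.eq]

end MixedForm

/-! ### Existence of semi-null pentads -/

section Pentads

variable {V : Type*} [AddCommGroup V] [Module ℝ V] {g : LinearMap.BilinForm ℝ V}

theorem SemiNullPentad.gram (P : SemiNullPentad g) :
    (g P.l P.l = 0 ∧ g P.l P.m = 1 ∧ g P.l P.x = 0 ∧ g P.l P.y = 0 ∧ g P.l P.z = 0) ∧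
    (g P.m P.l = 1 ∧ g P.m P.m = 0 ∧ g P.m P.x = 0 ∧ g P.m P.y = 0 ∧ g P.m P.z = 0) ∧
    (g P.x P.l = 0 ∧ g P.x P.m = 0 ∧ g P.x P.x = 1 ∧ g P.x P.y = 0 ∧ g P.x P.z = 0) ∧
    (g P.y P.l = 0 ∧ g P.y P.m = 0 ∧ g P.y P.x = 0 ∧ g P.y P.y = 1 ∧ g P.y P.z = 0) ∧
    (g P.z P.l = 0 ∧ g P.z P.m = 0 ∧ g P.z P.x = 0 ∧ g P.z P.y = 0 ∧ g P.z P.z = 1) :=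
  ⟨⟨P.inner_eq 0 0, P.inner_eq 0 1, P.inner_eq 0 2, P.inner_eq 0 3, P.inner_eq 0 4⟩,
   ⟨P.inner_eq 1 0, P.inner_eq 1 1, P.inner_eq 1 2, P.inner_eq 1 3, P.inner_eq 1 4⟩,
   ⟨P.inner_eq 2 0, P.inner_eq 2 1, P.inner_eq 2 2, P.inner_eq 2 3, P.inner_eq 2 4⟩,
   ⟨P.inner_eq 3 0, P.inner_eq 3 1, P.inner_eq 3 2, P.inner_eq 3 3, P.inner_eq 3 4⟩,
   ⟨P.inner_eq 4 0, P.inner_eq 4 1, P.inner_eq 4 2, P.inner_eq 4 3, P.inner_eq 4 4⟩⟩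

/-- Vectors with the inner products of a semi-null pentad form one. -/
theorem exists_semiNullPentad (hg : IsLorentzian g) {l m x y z : V}
    (hll : g l l = 0) (hlm : g l m = 1) (hlx : g l x = 0) (hly : g l y = 0) (hlz : g l z = 0)
    (hmm : g m m = 0) (hmx : g m x = 0) (hmy : g m y = 0) (hmz : g m z = 0)
    (hxx : g x x = 1) (hxy : g x y = 0) (hxz : g x z = 0)
    (hyy : g y y = 1) (hyz : g y z = 0) (hzz : g z z = 1) :
    ∃ P : SemiNullPentad g, P.l = l ∧ P.m = m ∧ P.x = x ∧ P.y = y ∧ P.z = z := by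
  have hml := (hg.symm m l).trans hlm
  have hxl := (hg.symm x l).trans hlx
  have hyl := (hg.symm y l).trans hly
  have hzl := (hg.symm z l).trans hlz
  have hxm := (hg.symm x m).trans hmx
  have hym := (hg.symm y m).trans hmy
  have hzm := (hg.symm z m).trans hmz
  have hyx := (hg.symm y x).trans hxy
  have hzx := (hg.symm z x).trans hxz
  have hzy := (hg.symm z y).trans hyz
  have hli : LinearIndependent ℝ ![l, m, x, y, z] := by
    rw [Fintype.linearIndependent_iff]
    intro c hc
    have key : ∀ w, c 0 * g w l + c 1 * g w m + c 2 * g w x + c 3 * g w y + c 4 * g w z = 0 := by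
      intro w
      have := congrArg (g w) hc
      simpa [Fin.sum_univ_five] using this
    have h0 := key m
    have h1 := key l
    have h2 := key x
    have h3 := key y
    have h4 := key z
    simp only [hll, hlm, hlx, hly, hlz, hmm, hmx, hmy, hmz, hxx, hxy, hxz, hyy, hyz, hzz, hml, hxl,
      hyl, hzl, hxm, hym, hzm, hyx, hzx, hzy, mul_zero, mul_one, add_zero, zero_add] at h0 h1 h2 h3 h4
    intro i
    fin_cases i <;> assumption
  have hcard : Fintype.card (Fin 5) = Module.finrank ℝ V := by simp [hg.finrank_eq]
  let b := basisOfLinearIndependentOfCardEqFinrank hli hcard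
  have hb : ∀ i, b i = ![l, m, x, y, z] i := fun i => by
    simp [b]
  refine ⟨⟨b, fun i j => ?_⟩, hb 0, hb 1, hb 2, hb 3, hb 4⟩
  rw [hb, hb]
  fin_cases i <;> fin_cases j <;> assumption

theorem IsLorentzian.exists_pentad (hg : IsLorentzian g) : Nonempty (SemiNullPentad g) := by
  obtain ⟨b, hb⟩ := id hg
  have h2 : √2 * √2 = 2 := Real.mul_self_sqrt (by norm_num)
  have h2' : √2 ≠ 0 := by positivity
  have hs : (√2)⁻¹ * (√2)⁻¹ = 1 / 2 := by rw [← mul_inv, h2]; norm_num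
  obtain ⟨P, -⟩ := exists_semiNullPentad hg (l := (√2)⁻¹ • (b 1 + b 0)) (m := (√2)⁻¹ • (b 1 - b 0))
    (x := b 2) (y := b 3) (z := b 4)
    (by simp [hb]) (by simp [hb]; linarith) (by simp [hb]) (by simp [hb]) (by simp [hb])
    (by simp [hb]) (by simp [hb]) (by simp [hb]) (by simp [hb])
    (by simp [hb]) (by simp [hb]) (by simp [hb]) (by simp [hb]) (by simp [hb]) (by simp [hb])
  exact ⟨P⟩

/-- The dual vectors make $v\mapsto(g(u_i,v))_i$ surjective, so rank-nullity gives the dimension of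
the orthogonal complement of a null pair or of a chain. -/
theorem finrank_ker_pi_of_dual [FiniteDimensional ℝ V] {k : ℕ} (u u' : Fin k → V)
    (h : ∀ i j, g (u i) (u' j) = if i = j then 1 else 0) :
    Module.finrank ℝ (LinearMap.ker (LinearMap.pi fun i => g (u i))) + k = Module.finrank ℝ V := by
  have hr : LinearMap.range (LinearMap.pi fun i => g (u i)) = ⊤ := by
    rw [LinearMap.range_eq_top]
    intro c
    refine ⟨∑ j, c j • u' j, ?_⟩
    ext i
    simp [h]
  have := LinearMap.finrank_range_add_finrank_ker (LinearMap.pi fun i => g (u i))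
  rw [hr, finrank_top, Module.finrank_fintype_fun_eq_card, Fintype.card_fin] at this
  omega

end Pentads

/-! ### From invariant subspaces to canonical expressions -/

section CanonicalForms

variable {V : Type*} [AddCommGroup V] [Module ℝ V] [FiniteDimensional ℝ V]
  {g : LinearMap.BilinForm ℝ V}

/-- An invariant null pair is completed to a semi-null pentad by eigenvectors. -/
theorem exists_pentad_of_null_pair (hg : IsLorentzian g) {T : V →ₗ[ℝ] V}
    (hT : ∀ u v, g (T u) v = g u (T v)) {l m : V} {a b c : ℝ}
    (hll : g l l = 0) (hlm : g l m = 1) (hmm : g m m = 0)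
    (hTl : T l = a • l + b • m) (hTm : T m = c • l + a • m) :
    ∃ P : SemiNullPentad g, P.l = l ∧ P.m = m ∧
      ∃ p q r : ℝ, T P.x = p • P.x ∧ T P.y = q • P.y ∧ T P.z = r • P.z := by
  let W : Submodule ℝ V := LinearMap.ker (LinearMap.pi fun i => g (![l, m] i))
  have hWmem : ∀ v, v ∈ W ↔ g l v = 0 ∧ g m v = 0 := fun v => by
    simp [W, LinearMap.mem_ker, funext_iff, Fin.forall_fin_two]
  have hdim : Module.finrank ℝ W = 3 := by
    have := finrank_ker_pi_of_dual (g := g) ![l, m] ![m, l] (by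
      intro i j
      fin_cases i <;> fin_cases j <;> simp [hll, hlm, hmm, hg.symm m l])
    rw [hg.finrank_eq] at this
    change Module.finrank ℝ W + 2 = 5 at this
    omega
  obtain ⟨e, d, heW, heg, heT⟩ := exists_orthonormal_eigenvectors hg.symm hT W
    (fun w hw => by
      rw [hWmem] at hw ⊢
      rw [← hT, ← hT, hTl, hTm]
      simp [hw.1, hw.2])
    (fun w hw hw0 => by
      rw [hWmem] at hw
      exact hg.pos_of_orthogonal_null_pair hll hlm hw.1 hw.2 hw0) hdim
  have h := fun i => (hWmem _).1 (heW i)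
  obtain ⟨P, h1, h2, h3, h4, h5⟩ := exists_semiNullPentad hg hll hlm (h 0).1 (h 1).1 (h 2).1 hmm
    (h 0).2 (h 1).2 (h 2).2 (heg 0 0) (heg 0 1) (heg 0 2) (heg 1 1) (heg 1 2) (heg 2 2)
  exact ⟨P, h1, h2, d 0, d 1, d 2, h3 ▸ heT 0, h4 ▸ heT 1, h5 ▸ heT 2⟩

/-- An invariant Jordan chain of length three is completed to a semi-null pentad by eigenvectors. -/
theorem exists_pentad_of_null_chain (hg : IsLorentzian g) {T : V →ₗ[ℝ] V}
    (hT : ∀ u v, g (T u) v = g u (T v)) {l m x : V} {a : ℝ}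
    (hll : g l l = 0) (hlm : g l m = 1) (hmm : g m m = 0) (hlx : g l x = 0) (hmx : g m x = 0)
    (hxx : g x x = 1) (hTl : T l = a • l) (hTx : T x = a • x + l) (hTm : T m = a • m + x) :
    ∃ P : SemiNullPentad g, P.l = l ∧ P.m = m ∧ P.x = x ∧
      ∃ q r : ℝ, T P.y = q • P.y ∧ T P.z = r • P.z := by
  let W : Submodule ℝ V := LinearMap.ker (LinearMap.pi fun i => g (![l, m, x] i))
  have hWmem : ∀ v, v ∈ W ↔ g l v = 0 ∧ g m v = 0 ∧ g x v = 0 := fun v => by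
    simp [W, LinearMap.mem_ker, funext_iff, Fin.forall_fin_succ]
  have hdim : Module.finrank ℝ W = 2 := by
    have := finrank_ker_pi_of_dual (g := g) ![l, m, x] ![m, l, x] (by
      intro i j
      fin_cases i <;> fin_cases j <;>
        simp [hll, hlm, hmm, hg.symm m l, hg.symm x l, hg.symm x m, hlx, hmx, hxx])
    rw [hg.finrank_eq] at this
    change Module.finrank ℝ W + 3 = 5 at this
    omega
  obtain ⟨e, d, heW, heg, heT⟩ := exists_orthonormal_eigenvectors hg.symm hT W
    (fun w hw => by
      rw [hWmem] at hw ⊢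
      rw [← hT, ← hT, ← hT, hTl, hTm, hTx]
      simp [hw.1, hw.2])
    (fun w hw hw0 => by
      rw [hWmem] at hw
      exact hg.pos_of_orthogonal_null_pair hll hlm hw.1 hw.2.1 hw0) hdim
  have h := fun i => (hWmem _).1 (heW i)
  obtain ⟨P, h1, h2, h3, h4, h5⟩ := exists_semiNullPentad hg hll hlm hlx (h 0).1 (h 1).1 hmm
    hmx (h 0).2.1 (h 1).2.1 hxx (h 0).2.2 (h 1).2.2 (heg 0 0) (heg 0 1) (heg 1 1)
  exact ⟨P, h1, h2, h3, d 0, d 1, h4 ▸ heT 0, h5 ▸ heT 1⟩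

/-- One expression covers three of the four types: $l_al_b$ sends $m$ to $l$ and $m_am_b$ sends $l$
to $m$, so their coefficients are the off-diagonal entries `c` and `b`. -/
theorem eq_canonical_plane_form (hg : IsLorentzian g) {R : LinearMap.BilinForm ℝ V}
    (P : SemiNullPentad g) {a b c p q r : ℝ}
    (hl : mixed g hg R P.l = a • P.l + b • P.m) (hm : mixed g hg R P.m = c • P.l + a • P.m)
    (hx : mixed g hg R P.x = p • P.x) (hy : mixed g hg R P.y = q • P.y)
    (hz : mixed g hg R P.z = r • P.z) :
    R = a • symProd g P.l P.m + c • prod g P.l P.l + b • prod g P.m P.m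
        + p • prod g P.x P.x + q • prod g P.y P.y + r • prod g P.z P.z := by
  refine eq_of_mixed_basis_eq hg P.basis fun i => ?_
  simp only [mixed_add, mixed_smul, mixed_symProd, mixed_prod]
  fin_cases i
  · refine hl.trans ?_
    change _ = a • (g P.l P.l • P.m + g P.m P.l • P.l) + c • g P.l P.l • P.l + b • g P.m P.l • P.m
      + p • g P.x P.l • P.x + q • g P.y P.l • P.y + r • g P.z P.l • P.z
    simp [P.gram]
  · refine hm.trans ?_
    change _ = a • (g P.l P.m • P.m + g P.m P.m • P.l) + c • g P.l P.m • P.l + b • g P.m P.m • P.m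
      + p • g P.x P.m • P.x + q • g P.y P.m • P.y + r • g P.z P.m • P.z
    simp [P.gram, add_comm]
  · refine hx.trans ?_
    change _ = a • (g P.l P.x • P.m + g P.m P.x • P.l) + c • g P.l P.x • P.l + b • g P.m P.x • P.m
      + p • g P.x P.x • P.x + q • g P.y P.x • P.y + r • g P.z P.x • P.z
    simp [P.gram]
  · refine hy.trans ?_
    change _ = a • (g P.l P.y • P.m + g P.m P.y • P.l) + c • g P.l P.y • P.l + b • g P.m P.y • P.m
      + p • g P.x P.y • P.x + q • g P.y P.y • P.y + r • g P.z P.y • P.z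
    simp [P.gram]
  · refine hz.trans ?_
    change _ = a • (g P.l P.z • P.m + g P.m P.z • P.l) + c • g P.l P.z • P.l + b • g P.m P.z • P.m
      + p • g P.x P.z • P.x + q • g P.y P.z • P.y + r • g P.z P.z • P.z
    simp [P.gram]

theorem eq_canonical_chain_form (hg : IsLorentzian g) {R : LinearMap.BilinForm ℝ V}
    (P : SemiNullPentad g) {a q r : ℝ}
    (hl : mixed g hg R P.l = a • P.l) (hm : mixed g hg R P.m = a • P.m + P.x)
    (hx : mixed g hg R P.x = a • P.x + P.l) (hy : mixed g hg R P.y = q • P.y)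
    (hz : mixed g hg R P.z = r • P.z) :
    R = a • symProd g P.l P.m + symProd g P.l P.x
        + a • prod g P.x P.x + q • prod g P.y P.y + r • prod g P.z P.z := by
  refine eq_of_mixed_basis_eq hg P.basis fun i => ?_
  simp only [mixed_add, mixed_smul, mixed_symProd, mixed_prod]
  fin_cases i
  · refine hl.trans ?_
    change _ = a • (g P.l P.l • P.m + g P.m P.l • P.l) + (g P.l P.l • P.x + g P.x P.l • P.l)
      + a • g P.x P.l • P.x + q • g P.y P.l • P.y + r • g P.z P.l • P.z
    simp [P.gram]
  · refine hm.trans ?_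
    change _ = a • (g P.l P.m • P.m + g P.m P.m • P.l) + (g P.l P.m • P.x + g P.x P.m • P.l)
      + a • g P.x P.m • P.x + q • g P.y P.m • P.y + r • g P.z P.m • P.z
    simp [P.gram]
  · refine hx.trans ?_
    change _ = a • (g P.l P.x • P.m + g P.m P.x • P.l) + (g P.l P.x • P.x + g P.x P.x • P.l)
      + a • g P.x P.x • P.x + q • g P.y P.x • P.y + r • g P.z P.x • P.z
    simp [P.gram, add_comm]
  · refine hy.trans ?_
    change _ = a • (g P.l P.y • P.m + g P.m P.y • P.l) + (g P.l P.y • P.x + g P.x P.y • P.l)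
      + a • g P.x P.y • P.x + q • g P.y P.y • P.y + r • g P.z P.y • P.z
    simp [P.gram]
  · refine hz.trans ?_
    change _ = a • (g P.l P.z • P.m + g P.m P.z • P.l) + (g P.l P.z • P.x + g P.x P.z • P.l)
      + a • g P.x P.z • P.x + q • g P.y P.z • P.y + r • g P.z P.z • P.z
    simp [P.gram]

end CanonicalForms

/-! ### Every symmetric tensor has a canonical form -/

section Existence

variable {V : Type*} [AddCommGroup V] [Module ℝ V] [FiniteDimensional ℝ V]
  {g : LinearMap.BilinForm ℝ V}

/-- Replacing $(l,m)$ by $(\sigma l,\sigma^{-1}m)$ turns $(b,c)$ into $(b\sigma^2,c\sigma^{-2})$. If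
$b=c=0$ or $bc>0$ the type is of the family $[1,1111]$, if exactly one vanishes $[2111]$, if $bc<0$
$[z\bar z111]$. -/
theorem hasCanonicalForm_of_null_pair (hg : IsLorentzian g) {R : LinearMap.BilinForm ℝ V}
    (hR : R.IsSymm) {l m : V} {a b c : ℝ} (hll : g l l = 0) (hlm : g l m = 1) (hmm : g m m = 0)
    (hTl : mixed g hg R l = a • l + b • m) (hTm : mixed g hg R m = c • l + a • m) :
    ∃ F s, HasCanonicalForm g R s F := by
  have scaled : ∀ σ : ℝ, σ ≠ 0 → ∃ (P : SemiNullPentad g) (p q r : ℝ),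
      R = a • symProd g P.l P.m + (c * (σ⁻¹ * σ⁻¹)) • prod g P.l P.l
        + (b * (σ * σ)) • prod g P.m P.m
        + p • prod g P.x P.x + q • prod g P.y P.y + r • prod g P.z P.z := by
    intro σ hσ
    have hl : mixed g hg R (σ • l) = a • (σ • l) + (b * (σ * σ)) • (σ⁻¹ • m) := by
      rw [map_smul, hTl]
      match_scalars <;> field_simp
    have hm : mixed g hg R (σ⁻¹ • m) = (c * (σ⁻¹ * σ⁻¹)) • (σ • l) + a • (σ⁻¹ • m) := by
      rw [map_smul, hTm]
      match_scalars <;> field_simp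
    obtain ⟨P, h1, h2, p, q, r, hx, hy, hz⟩ := exists_pentad_of_null_pair hg
      (mixed_selfAdjoint hg hR) (by simp [hll]) (by simp [hlm, hσ]) (by simp [hmm]) hl hm
    rw [← h1, ← h2] at hl hm
    exact ⟨P, p, q, r, eq_canonical_plane_form hg P hl hm hx hy hz⟩
  -- Exchanging the two null vectors moves the surviving off-diagonal entry `b` to the coefficient
  -- of $l_al_b$.
  have swapped : c = 0 → ∀ σ : ℝ, σ ≠ 0 → ∃ (P : SemiNullPentad g) (p q r : ℝ),
      R = a • symProd g P.l P.m + (b * (σ⁻¹ * σ⁻¹)) • prod g P.l P.l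
        + p • prod g P.x P.x + q • prod g P.y P.y + r • prod g P.z P.z := by
    intro hc σ hσ
    have hl : mixed g hg R (σ • m) = a • (σ • m) + (0 : ℝ) • (σ⁻¹ • l) := by
      rw [map_smul, hTm, hc]
      module
    have hm : mixed g hg R (σ⁻¹ • l) = (b * (σ⁻¹ * σ⁻¹)) • (σ • m) + a • (σ⁻¹ • l) := by
      rw [map_smul, hTl]
      match_scalars <;> field_simp
    obtain ⟨P, h1, h2, p, q, r, hx, hy, hz⟩ := exists_pentad_of_null_pair hg
      (mixed_selfAdjoint hg hR) (by simp [hmm]) (by simp [hlm, hg.symm m l, hσ]) (by simp [hll])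
      hl hm
    rw [← h1, ← h2] at hl hm
    refine ⟨P, p, q, r, ?_⟩
    simpa using eq_canonical_plane_form hg P hl hm hx hy hz
  have hsq : ∀ t : ℝ, t ≠ 0 → √|t| ≠ 0 ∧
      (t * ((√|t|)⁻¹ * (√|t|)⁻¹) = 1 ∨ t * ((√|t|)⁻¹ * (√|t|)⁻¹) = -1) := by
    intro t ht
    refine ⟨Real.sqrt_ne_zero'.2 (abs_pos.2 ht), ?_⟩
    rw [← mul_inv, Real.mul_self_sqrt (abs_nonneg t)]
    rcases abs_choice t with h | h
    · left; rw [h]; field_simp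
    · right; rw [h]; field_simp
  by_cases hb : b = 0
  · by_cases hc : c = 0
    · obtain ⟨P, p, q, r, h⟩ := scaled 1 one_ne_zero
      refine ⟨.type11111, _, P, a, 0, p, q, r, ?_, rfl⟩
      simpa [hb, hc] using h
    · obtain ⟨h0, h1⟩ := hsq c hc
      obtain ⟨P, p, q, r, h⟩ := scaled _ h0
      refine ⟨.type2111, _, P, _, a, p, q, r, h1, ?_, rfl⟩
      simpa [hb] using h
  · by_cases hc : c = 0
    · obtain ⟨h0, h1⟩ := hsq b hb
      obtain ⟨P, p, q, r, h⟩ := swapped hc _ h0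
      exact ⟨.type2111, _, P, _, a, p, q, r, h1, h, rfl⟩
    · have hpos : 0 < |c / b| := abs_pos.2 (div_ne_zero hc hb)
      -- With $\sigma=|c/b|^{1/4}$ both off-diagonal entries get the same absolute value; the sign
      -- of $c/b$ decides whether they are equal or opposite.
      have hσ : √(√|c / b|) ≠ 0 := by positivity
      have hσ2 : √(√|c / b|) * √(√|c / b|) = √|c / b| := Real.mul_self_sqrt (Real.sqrt_nonneg _)
      obtain ⟨P, p, q, r, h⟩ := scaled _ hσ
      rw [← mul_inv, hσ2] at h
      have hne : √|c / b| ≠ 0 := by positivity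
      have h4 : √|c / b| * √|c / b| = |c / b| := Real.mul_self_sqrt (abs_nonneg _)
      rcases abs_choice (c / b) with h5 | h5
      · refine ⟨.type11111, _, P, a, b * √|c / b|, p, q, r, ?_, rfl⟩
        have : c * (√|c / b|)⁻¹ = b * √|c / b| := by
          have h6 : b * (√|c / b| * √|c / b|) = c := by rw [h4, h5]; field_simp
          field_simp
          linarith
        rw [this] at h
        rw [smul_add, ← add_assoc]
        exact h
      · refine ⟨.typeZZ111, _, P, a, -(b * √|c / b|), p, q, r, neg_ne_zero.2 (mul_ne_zero hb hne),
          ?_, rfl⟩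
        have : c * (√|c / b|)⁻¹ = -(b * √|c / b|) := by
          have h6 : b * (√|c / b| * √|c / b|) = -c := by rw [h4, h5]; field_simp
          field_simp
          linarith
        rw [this] at h
        refine h.trans ?_
        ext v w
        simp only [LinearMap.add_apply, LinearMap.sub_apply, LinearMap.smul_apply, smul_eq_mul]
        ring

theorem hasCanonicalForm_of_null_mem (hg : IsLorentzian g) {R : LinearMap.BilinForm ℝ V}
    (hR : R.IsSymm) {u v : V} (huu : g u u = 0) (huv : g u v ≠ 0)
    (hTu : mixed g hg R u ∈ Submodule.span ℝ {u, v})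
    (hTv : mixed g hg R v ∈ Submodule.span ℝ {u, v}) :
    ∃ F s, HasCanonicalForm g R s F := by
  obtain ⟨d, hd⟩ : ∃ d, d = g u v := ⟨_, rfl⟩
  obtain ⟨e, he⟩ : ∃ e, e = g v v := ⟨_, rfl⟩
  rw [← hd] at huv
  -- The second null direction of the plane, normalised by $g(u,m)=1$.
  obtain ⟨m, hm⟩ : ∃ m, m = d⁻¹ • v - (e / (2 * d ^ 2)) • u := ⟨_, rfl⟩
  have hvu : g v u = d := by rw [hg.symm, hd]
  have hv : v = d • m + (e / (2 * d)) • u := by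
    rw [hm]
    match_scalars <;> field_simp
    ring
  have hum : g u m = 1 := by rw [hm]; simp [huu, ← hd, huv]
  have hmm : g m m = 0 := by
    rw [hm]
    simp only [map_sub, LinearMap.sub_apply, map_smul, LinearMap.smul_apply, smul_eq_mul, huu, ← hd,
      hvu, ← he]
    field_simp
    ring
  have hmu : g m u = 1 := by rw [hg.symm, hum]
  have hmem : ∀ w ∈ Submodule.span ℝ {u, v}, w = g w m • u + g w u • m := by
    intro w hw
    obtain ⟨α, β, rfl⟩ := Submodule.mem_span_pair.1 hw
    rw [hv]
    simp only [map_add, LinearMap.add_apply, map_smul, LinearMap.smul_apply, smul_eq_mul, huu, hum,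
      hmm, hmu]
    module
  have hTm : mixed g hg R m ∈ Submodule.span ℝ {u, v} := by
    have h : mixed g hg R m = d⁻¹ • mixed g hg R v - (e / (2 * d ^ 2)) • mixed g hg R u := by
      conv_lhs => rw [hm]
      rw [map_sub, map_smul, map_smul]
    rw [h]
    exact Submodule.sub_mem _ (Submodule.smul_mem _ _ hTv) (Submodule.smul_mem _ _ hTu)
  have h1 := hmem _ hTu
  have h2 := hmem _ hTm
  -- Self-adjointness makes the two diagonal entries of $T$ in the null basis agree.
  have h3 : g (mixed g hg R m) u = g (mixed g hg R u) m := by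
    rw [mixed_selfAdjoint hg hR, hg.symm]
  rw [h3] at h2
  exact hasCanonicalForm_of_null_pair hg hR huu hum hmm h1 h2

/-- A plane with negative Gram determinant is Lorentzian, so it contains a null vector not
orthogonal to the whole plane. -/
theorem hasCanonicalForm_of_invariant_plane (hg : IsLorentzian g) {R : LinearMap.BilinForm ℝ V}
    (hR : R.IsSymm) {u v : V} (huv : g u u * g v v < g u v ^ 2)
    (hTu : mixed g hg R u ∈ Submodule.span ℝ {u, v})
    (hTv : mixed g hg R v ∈ Submodule.span ℝ {u, v}) :
    ∃ F s, HasCanonicalForm g R s F := by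
  by_cases hu : g u u = 0
  · refine hasCanonicalForm_of_null_mem hg hR hu ?_ hTu hTv
    intro h
    rw [hu, h] at huv
    simp at huv
  obtain ⟨D, hD⟩ : ∃ D, D = g u v ^ 2 - g u u * g v v := ⟨_, rfl⟩
  have hDpos : 0 < D := by rw [hD]; linarith
  have hDs : √D * √D = D := Real.mul_self_sqrt hDpos.le
  -- A root of $g(tu+v,tu+v)=0$, a quadratic equation in $t$ whose reduced discriminant is `D`.
  obtain ⟨t, ht⟩ : ∃ t, t = (-g u v + √D) / g u u := ⟨_, rfl⟩
  have hta : t * g u u = -g u v + √D := by rw [ht]; field_simp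
  have hvu : g v u = g u v := hg.symm v u
  have hspan : Submodule.span ℝ {t • u + v, u} = Submodule.span ℝ {u, v} := by
    apply le_antisymm <;> rw [Submodule.span_le, Set.insert_subset_iff, Set.singleton_subset_iff]
    · exact ⟨Submodule.mem_span_pair.2 ⟨t, 1, by simp⟩, Submodule.mem_span_pair.2 ⟨1, 0, by simp⟩⟩
    · exact ⟨Submodule.mem_span_pair.2 ⟨0, 1, by simp⟩, Submodule.mem_span_pair.2 ⟨1, -t, by simp⟩⟩
  refine hasCanonicalForm_of_null_mem hg hR (u := t • u + v) (v := u) ?_ ?_ ?_ ?_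
  · simp only [map_add, LinearMap.add_apply, map_smul, LinearMap.smul_apply, smul_eq_mul, hvu]
    have h1 : g u u * (t * (t * g u u) + t * g u v + (t * g u v + g v v)) = 0 := by
      have : g u u * (t * (t * g u u) + t * g u v + (t * g u v + g v v))
        = (t * g u u) ^ 2 + 2 * (t * g u u) * g u v + g u u * g v v := by ring
      rw [this, hta]
      nlinarith
    have h2 := (mul_eq_zero.1 h1).resolve_left hu
    linarith
  · simp only [map_add, LinearMap.add_apply, map_smul, LinearMap.smul_apply, smul_eq_mul, hvu, hta]
    have : √D ≠ 0 := by positivity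
    simpa using this
  · rw [hspan, map_add, map_smul]
    exact Submodule.add_mem _ (Submodule.smul_mem _ _ hTu) hTv
  · rw [hspan]; exact hTu

/-- The complement of `t` is Euclidean and invariant, hence contains a unit eigenvector; together
with `t` it spans an invariant Lorentzian plane. -/
theorem hasCanonicalForm_of_timelike_eigenvector (hg : IsLorentzian g)
    {R : LinearMap.BilinForm ℝ V} (hR : R.IsSymm) {t : V} {c : ℝ} (ht : g t t < 0)
    (hTt : mixed g hg R t = c • t) : ∃ F s, HasCanonicalForm g R s F := by
  have ht0 : t ≠ 0 := by rintro rfl; simp at ht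
  let W : Submodule ℝ V := LinearMap.ker (g t)
  have hdim : Module.finrank ℝ W + 1 = 5 := by
    rw [← hg.finrank_eq, add_comm]
    have h1 := LinearMap.finrank_range_add_finrank_ker (g t)
    have h2 : LinearMap.range (g t) = ⊤ := by
      refine LinearMap.range_eq_top.2 fun r => ⟨(r / g t t) • t, ?_⟩
      simp [div_mul_cancel₀ _ ht.ne]
    rw [h2, finrank_top, Module.finrank_self] at h1
    exact h1
  have hpos : ∀ w ∈ W, w ≠ 0 → 0 < g w w := by
    intro w hw hw0
    obtain ⟨h1, h2⟩ := hg.nonneg_of_orthogonal ht0 ht.le hw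
    refine lt_of_le_of_ne h1 fun h => ?_
    obtain ⟨κ, rfl⟩ := h2 h.symm
    have hw' : g t (κ • t) = 0 := hw
    rw [map_smul, smul_eq_mul, mul_eq_zero] at hw'
    rcases hw' with h | h
    · simp [h] at hw0
    · exact ht.ne h
  obtain ⟨e, d, heW, heg, heT⟩ := exists_orthonormal_eigenvectors hg.symm
    (mixed_selfAdjoint hg hR) W
    (fun w (hw : g t w = 0) => by
      change g t (mixed g hg R w) = 0
      rw [← mixed_selfAdjoint hg hR, hTt]
      simp [hw]) hpos (k := 4) (by omega)
  have he : g t (e 0) = 0 := heW 0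
  have hee : g (e 0) (e 0) = 1 := heg 0 0
  refine hasCanonicalForm_of_invariant_plane hg hR (u := t) (v := e 0) ?_ ?_ ?_
  · rw [he, hee]; linarith
  · exact Submodule.mem_span_pair.2 ⟨c, 0, by simp [hTt]⟩
  · exact Submodule.mem_span_pair.2 ⟨0, d 0, by simp [heT]⟩

theorem hasCanonicalForm_of_complex_pair (hg : IsLorentzian g)
    {R : LinearMap.BilinForm ℝ V} (hR : R.IsSymm) {u v : V} {α β : ℝ} (hv : v ≠ 0) (hβ : β ≠ 0)
    (hTv : mixed g hg R v = α • v - β • u) (hTu : mixed g hg R u = β • v + α • u) :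
    ∃ F s, HasCanonicalForm g R s F := by
  -- Comparing $g(Tu,v)$ with $g(u,Tv)$ shows that the Gram matrix of $u,v$ is trace-free. Its
  -- determinant is then negative, unless all entries vanish; in that case $u=\kappa v$, which
  -- forces $\beta(1+\kappa^2)v=0$.
  have hsum : g u u + g v v = 0 := by
    have h := mixed_selfAdjoint hg hR u v
    rw [hTu, hTv] at h
    simp only [map_add, map_sub, LinearMap.add_apply, map_smul, LinearMap.smul_apply,
      smul_eq_mul] at h
    have : β * (g u u + g v v) = 0 := by linarith
    exact (mul_eq_zero.1 this).resolve_left hβ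
  refine hasCanonicalForm_of_invariant_plane hg hR (u := u) (v := v) ?_ ?_ ?_
  · have hu : g u u = -g v v := by linarith
    rw [hu]
    by_contra hcon
    push Not at hcon
    have h1 := sq_nonneg (g u v)
    have h2 := sq_nonneg (g v v)
    have hvv : g v v = 0 := by
      apply pow_eq_zero_iff (two_ne_zero) |>.1; nlinarith
    have huv : g u v = 0 := by
      apply pow_eq_zero_iff (two_ne_zero) |>.1; nlinarith
    obtain ⟨κ, rfl⟩ := (hg.nonneg_of_orthogonal hv hvv.le ((hg.symm v u).trans huv)).2
      (by rw [hu, hvv, neg_zero])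
    rw [map_smul, hTv] at hTu
    have : (β * (1 + κ ^ 2)) • v = 0 := by
      rw [← sub_eq_zero] at hTu
      rw [← neg_eq_zero, ← hTu]
      module
    have h3 : 1 + κ ^ 2 ≠ 0 := by positivity
    exact (smul_ne_zero (mul_ne_zero hβ h3) hv) this
  · exact Submodule.mem_span_pair.2 ⟨α, β, by rw [hTu, add_comm]⟩
  · exact Submodule.mem_span_pair.2 ⟨-β, α, by rw [hTv]; module⟩

theorem hasCanonicalForm_of_null_eigenvector (hg : IsLorentzian g)
    {R : LinearMap.BilinForm ℝ V} (hR : R.IsSymm) {l : V} {a : ℝ} (hl : l ≠ 0) (hll : g l l = 0)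
    (hTl : mixed g hg R l = a • l) : ∃ F s, HasCanonicalForm g R s F := by
  obtain ⟨T, hTdef⟩ : ∃ T, T = mixed g hg R := ⟨_, rfl⟩
  have hT := mixed_selfAdjoint hg hR
  rw [← hTdef] at hT hTl
  let N : V →ₗ[ℝ] V := T - a • LinearMap.id
  have hTN : ∀ v, T v = a • v + N v := fun v => by simp [N]
  have hN : ∀ u v, g (N u) v = g u (N v) := fun u v => by simp [N, hT]
  have hNl : N l = 0 := by simp [N, hTl]
  -- Either $l$ ends a Jordan chain of length three, or a partner of $l$ can be found in $\ker N^2$.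
  by_cases hrange : ∃ m, N (N m) = l
  · obtain ⟨m₀, hm₀⟩ := hrange
    obtain ⟨x₀, hx₀⟩ : ∃ x₀, x₀ = N m₀ := ⟨_, rfl⟩
    rw [← hx₀] at hm₀
    have hlx₀ : g l x₀ = 0 := by
      conv_lhs => rw [hx₀, ← hN, hNl]
      simp
    obtain ⟨s, hs⟩ : ∃ s, s = g x₀ x₀ := ⟨_, rfl⟩
    have hspos : 0 < s := by
      obtain ⟨h1, h2⟩ := hg.nonneg_of_orthogonal hl hll.le hlx₀
      rw [hs]
      refine lt_of_le_of_ne h1 fun h => ?_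
      obtain ⟨κ, hκ⟩ := h2 h.symm
      rw [hκ, map_smul, hNl, smul_zero] at hm₀
      exact hl hm₀.symm
    have hlm₀ : g l m₀ = s := by
      rw [← hm₀, hN, ← hx₀, hs]
    obtain ⟨σ, hσ⟩ : ∃ σ, σ = (√s)⁻¹ := ⟨_, rfl⟩
    have hσσ : σ * σ * s = 1 := by
      rw [hσ, ← mul_inv, Real.mul_self_sqrt hspos.le, inv_mul_cancel₀ hspos.ne']
    -- The chain is regenerated from $m=\sigma(1+pN+qN^2)m_0$, which keeps all chain relations:
    -- $\sigma$ normalises $g(x,x)$ and $g(l,m)$, $p$ achieves $g(m,x)=0$, and $q$ achieves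
    -- $g(m,m)=0$.
    obtain ⟨p, hp⟩ : ∃ p, p = -(σ * σ * g x₀ m₀) / 2 := ⟨_, rfl⟩
    obtain ⟨q, hq⟩ : ∃ q, q = -(σ * σ * g m₀ m₀ + 2 * p * (σ * σ * g x₀ m₀) + p * p) / 2 :=
      ⟨_, rfl⟩
    have hml := hg.symm m₀ l
    have hmx := hg.symm m₀ x₀
    have hxl := hg.symm x₀ l
    obtain ⟨P, h1, h2, h3, c, d, h4, h5⟩ := exists_pentad_of_null_chain hg hT (l := σ • l)
      (m := σ • m₀ + p • (σ • x₀) + q • (σ • l)) (x := σ • x₀ + p • (σ • l)) (a := a)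
      (by simp [hll])
      (by
        simp only [map_add, map_smul, LinearMap.smul_apply, smul_eq_mul, hll, hlx₀, hlm₀]
        linarith)
      (by
        simp only [map_add, LinearMap.add_apply, map_smul, LinearMap.smul_apply, smul_eq_mul, hll,
          hlx₀, hlm₀, hml, hmx, hxl, ← hs]
        have : q * 2 = -(σ * σ * g m₀ m₀ + 2 * p * (σ * σ * g x₀ m₀) + p * p) := by
          rw [hq]; ring
        linear_combination (2 * q + p * p) * hσσ + this)
      (by
        simp only [map_add, map_smul, LinearMap.smul_apply, smul_eq_mul, hll, hlx₀]
        ring)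
      (by
        simp only [map_add, LinearMap.add_apply, map_smul, LinearMap.smul_apply, smul_eq_mul, hll,
          hlx₀, hlm₀, hml, hmx, hxl, ← hs]
        have : p * 2 = -(σ * σ * g x₀ m₀) := by rw [hp]; ring
        linear_combination (2 * p) * hσσ + this)
      (by
        simp only [map_add, LinearMap.add_apply, map_smul, LinearMap.smul_apply, smul_eq_mul, hll,
          hlx₀, hxl, ← hs]
        linear_combination hσσ)
      (by rw [map_smul, hTl, smul_comm])
      (by
        simp only [map_add, map_smul, hTN, hm₀, hNl]
        module)
      (by
        simp only [map_add, map_smul, hTN, hm₀, hNl, ← hx₀]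
        module)
    have hl' : T P.l = a • P.l := by rw [h1, map_smul, hTl, smul_comm]
    have hx' : T P.x = a • P.x + P.l := by
      rw [h1, h3]
      simp only [map_add, map_smul, hTN, hm₀, hNl]
      module
    have hm' : T P.m = a • P.m + P.x := by
      rw [h2, h3]
      simp only [map_add, map_smul, hTN, hm₀, hNl, ← hx₀]
      module
    rw [hTdef] at hl' hm' hx' h4 h5
    exact ⟨.type311, _, P, a, c, d, eq_canonical_chain_form hg P hl' hm' hx' h4 h5, rfl⟩
  -- Otherwise $l\in(\ker N^2)^\perp$. By self-adjointness and a dimension count this complement is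
  -- the range of $N^2$, contrary to the case assumption.
  · have hmem : ∃ p, N (N p) = 0 ∧ g l p ≠ 0 := by
      by_contra! hcon
      have hker : LinearMap.ker (N * N) ≤ LinearMap.ker (g l) := fun p hp => hcon p hp
      have hrk : LinearMap.range (N * N) ≤ g.orthogonal (LinearMap.ker (N * N)) := by
        rintro _ ⟨w, rfl⟩ p hp
        have hp' : N (N p) = 0 := hp
        change g p (N (N w)) = 0
        rw [← hN, ← hN, hp']
        simp
      have hdim : Module.finrank ℝ (LinearMap.range (N * N))
          = Module.finrank ℝ (g.orthogonal (LinearMap.ker (N * N))) := by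
        have h1 := LinearMap.finrank_range_add_finrank_ker (N * N)
        have h2 := LinearMap.BilinForm.finrank_orthogonal hg.nondegenerate (LinearMap.ker (N * N))
        omega
      have heq := Submodule.eq_of_le_of_finrank_eq hrk hdim
      have hlmem : l ∈ LinearMap.range (N * N) := by
        rw [heq]
        intro p hp
        change g p l = 0
        rw [hg.symm]
        exact hker hp
      obtain ⟨m, hm⟩ := hlmem
      exact hrange ⟨m, hm⟩
    obtain ⟨p, hp, hlp⟩ := hmem
    have h1 : g l (N p) = 0 := by rw [← hN, hNl]; simp
    have h2 : g (N p) (N p) = 0 := by rw [hN, hp]; simp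
    -- $Np$ is null and orthogonal to $l$, hence a multiple of $l$; so the span of $l,p$ is
    -- invariant.
    obtain ⟨κ, hκ⟩ := (hg.nonneg_of_orthogonal hl hll.le h1).2 h2
    refine hasCanonicalForm_of_null_mem hg hR (u := l) (v := p) hll hlp ?_ ?_
    · rw [← hTdef]
      exact Submodule.mem_span_pair.2 ⟨a, 0, by simp [hTl]⟩
    · rw [← hTdef]
      exact Submodule.mem_span_pair.2 ⟨κ, a, by rw [hTN, hκ, add_comm]⟩

theorem exists_hasCanonicalForm (hg : IsLorentzian g) {R : LinearMap.BilinForm ℝ V}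
    (hR : R.IsSymm) : ∃ F s, HasCanonicalForm g R s F := by
  obtain ⟨P⟩ := hg.exists_pentad
  have hl : P.l ≠ 0 := P.basis.ne_zero 0
  obtain ⟨v, hv, ⟨hvv, c, hc⟩ | ⟨u, α, β, hβ, h1, h2⟩⟩ :=
    exists_nonspacelike_eigenvector_or_complex_pair hg.symm (mixed_selfAdjoint hg hR) _ ⊤ rfl
      (fun _ _ => trivial) ⟨P.l, trivial, hl, P.gram.1.1.le⟩
  · rcases hvv.lt_or_eq with h | h
    · exact hasCanonicalForm_of_timelike_eigenvector hg hR h hc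
    · exact hasCanonicalForm_of_null_eigenvector hg hR hv h hc
  · exact hasCanonicalForm_of_complex_pair hg hR hv hβ h1 h2

end Existence

/-! ### Counting the degeneracies -/

section Counting

/-- Comparison through natural numbers gives a decidable equality that the kernel can evaluate in
the count. -/
def EigenvalueKind.toNat : EigenvalueKind → ℕ
  | .real => 0
  | .timelike => 1
  | .z => 2
  | .zbar => 3

theorem EigenvalueKind.toNat_inj (a b : EigenvalueKind) : a.toNat = b.toNat ↔ a = b := by
  cases a <;> cases b <;> simp [EigenvalueKind.toNat]

instance : DecidableEq EigenvalueKind := fun a b =>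
  decidable_of_iff _ (EigenvalueKind.toNat_inj a b)

theorem SegreGroup.eq_iff (a b : SegreGroup) :
    (a.kind = b.kind ∧ a.blocks = b.blocks) ↔ a = b := by
  cases a; cases b; simp

instance : DecidableEq SegreGroup := fun a b => decidable_of_iff _ (SegreGroup.eq_iff a b)

/-- The symbols that arise from `s` by letting two distinct real eigenvalues become equal. -/
def bracketings (s : SegreSymbol) : Multiset SegreSymbol :=
  s.bind fun a => (s.erase a).bind fun b =>
    if (a.kind = .real ∨ a.kind = .timelike) ∧ b.kind = .real
    then {⟨a.kind, a.blocks + b.blocks⟩ ::ₘ (s.erase a).erase b} else 0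

theorem mem_bracketings {s s' : SegreSymbol} : s' ∈ bracketings s ↔ Brackets s s' := by
  simp only [bracketings, Multiset.mem_bind]
  constructor
  · rintro ⟨a, ha, b, hb, h⟩
    split_ifs at h with hk
    · rw [Multiset.mem_singleton] at h
      exact ⟨a, b, (s.erase a).erase b, hk.1, hk.2, by
        rw [Multiset.cons_erase hb, Multiset.cons_erase ha], h⟩
    · simp at h
  · rintro ⟨a, b, t, ha, hb, rfl, rfl⟩
    refine ⟨a, by simp, b, by simp, ?_⟩
    rw [if_pos ⟨ha, hb⟩]
    simp

/-- The symbols that arise from the four types by letting `k` pairs of eigenvalues become equal. -/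
def degeneraciesOfOrder : ℕ → Finset SegreSymbol
  | 0 => {SegreClass.type11111.symbol, SegreClass.type2111.symbol, SegreClass.type311.symbol,
      SegreClass.typeZZ111.symbol}
  | k + 1 => (degeneraciesOfOrder k).biUnion fun s => (bracketings s).toFinset

theorem SegreClass.symbol_mem_degeneraciesOfOrder (F : SegreClass) :
    F.symbol ∈ degeneraciesOfOrder 0 := by
  cases F <;> simp [degeneraciesOfOrder]

theorem exists_symbol_of_mem_degeneraciesOfOrder {s : SegreSymbol}
    (hs : s ∈ degeneraciesOfOrder 0) : ∃ F : SegreClass, s = F.symbol := by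
  simp only [degeneraciesOfOrder, Finset.mem_insert, Finset.mem_singleton] at hs
  rcases hs with h | h | h | h
  exacts [⟨_, h⟩, ⟨_, h⟩, ⟨_, h⟩, ⟨_, h⟩]

theorem exists_isDegeneracy_iff {s : SegreSymbol} :
    (∃ F : SegreClass, F.IsDegeneracy s) ↔ ∃ k, s ∈ degeneraciesOfOrder (k + 1) := by
  constructor
  · rintro ⟨F, h⟩
    induction h with
    | single h =>
      exact ⟨0, Finset.mem_biUnion.2 ⟨_, F.symbol_mem_degeneraciesOfOrder,
        Multiset.mem_toFinset.2 (mem_bracketings.2 h)⟩⟩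
    | tail _ h ih =>
      obtain ⟨k, hk⟩ := ih
      exact ⟨k + 1, Finset.mem_biUnion.2 ⟨_, hk, Multiset.mem_toFinset.2 (mem_bracketings.2 h)⟩⟩
  · rintro ⟨k, hk⟩
    induction k generalizing s with
    | zero =>
      obtain ⟨s₀, h0, h⟩ := Finset.mem_biUnion.1 hk
      obtain ⟨F, rfl⟩ := exists_symbol_of_mem_degeneraciesOfOrder h0
      exact ⟨F, .single (mem_bracketings.1 (Multiset.mem_toFinset.1 h))⟩
    | succ k ih =>
      obtain ⟨s₀, h0, h⟩ := Finset.mem_biUnion.1 hk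
      obtain ⟨F, hF⟩ := ih h0
      exact ⟨F, hF.tail (mem_bracketings.1 (Multiset.mem_toFinset.1 h))⟩

/-- Each merging lowers the number of groups by one and a symbol starts with at most five, so no
degeneracy has order five. -/
theorem degeneraciesOfOrder_five : degeneraciesOfOrder 5 = ∅ := by
  decide +kernel

theorem card_degeneracies : (degeneraciesOfOrder 1 ∪ degeneraciesOfOrder 2 ∪ degeneraciesOfOrder 3
    ∪ degeneraciesOfOrder 4).card = 22 := by
  decide +kernel

theorem ncard_degeneracies : {s : SegreSymbol | ∃ F : SegreClass, F.IsDegeneracy s}.ncard = 22 := by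
  rw [← card_degeneracies, ← Set.ncard_coe_finset]
  congr 1
  ext s
  have hempty : ∀ k, degeneraciesOfOrder (k + 5) = ∅ := by
    intro k
    induction k with
    | zero => exact degeneraciesOfOrder_five
    | succ k ih =>
      change (degeneraciesOfOrder (k + 5)).biUnion _ = ∅
      rw [ih, Finset.biUnion_empty]
  simp only [Set.mem_ofPred_eq, exists_isDegeneracy_iff, Finset.coe_union, Set.mem_union,
    Finset.mem_coe]
  constructor
  · rintro ⟨k, hk⟩
    rcases k with _ | _ | _ | _ | k
    · exact Or.inl (Or.inl (Or.inl hk))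
    · exact Or.inl (Or.inl (Or.inr hk))
    · exact Or.inl (Or.inr hk)
    · exact Or.inr hk
    · have := hempty k
      rw [show k + 1 + 1 + 1 + 1 + 1 = k + 5 from rfl, this] at hk
      simp at hk
  · rintro (((h | h) | h) | h)
    exacts [⟨0, h⟩, ⟨1, h⟩, ⟨2, h⟩, ⟨3, h⟩]

end Counting

/-! ### Invariants separating the four families -/

section Disjointness

theorem Brackets.blocks_eq {s s' : SegreSymbol} (h : Brackets s s') :
    (s'.map SegreGroup.blocks).sum = (s.map SegreGroup.blocks).sum := by
  obtain ⟨a, b, t, -, -, rfl, rfl⟩ := h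
  simp [add_assoc]

theorem Brackets.countP_z_eq {s s' : SegreSymbol} (h : Brackets s s') :
    s'.countP (fun G => G.kind = .z) = s.countP (fun G => G.kind = .z) := by
  obtain ⟨a, b, t, -, hb, rfl, rfl⟩ := h
  simp [Multiset.countP_cons, hb]

theorem SegreClass.reflTransGen_iff {F : SegreClass} {s : SegreSymbol} :
    Relation.ReflTransGen Brackets F.symbol s ↔ s = F.symbol ∨ F.IsDegeneracy s :=
  Relation.reflTransGen_iff_eq_or_transGen

/-- The multiset of all block dimensions separates everything except $[1,1111]$ and $[z\bar z111]$,
which differ in the number of letters $z$. -/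
theorem SegreClass.eq_of_reflTransGen {F F' : SegreClass} {s : SegreSymbol}
    (h : Relation.ReflTransGen Brackets F.symbol s)
    (h' : Relation.ReflTransGen Brackets F'.symbol s) : F = F' := by
  have hinv : ∀ s₀ s₁ : SegreSymbol, Relation.ReflTransGen Brackets s₀ s₁ →
      (s₁.map SegreGroup.blocks).sum = (s₀.map SegreGroup.blocks).sum ∧
      s₁.countP (fun G => G.kind = .z) = s₀.countP (fun G => G.kind = .z) := by
    intro s₀ s₁ h
    induction h with
    | refl => exact ⟨rfl, rfl⟩
    | tail _ h ih => exact ⟨h.blocks_eq.trans ih.1, h.countP_z_eq.trans ih.2⟩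
  have h1 := (hinv _ _ h).1.symm.trans (hinv _ _ h').1
  have h2 := (hinv _ _ h).2.symm.trans (hinv _ _ h').2
  revert h1 h2
  cases F <;> cases F' <;> first | (intros; rfl) | (intro h1 h2; exfalso; revert h1 h2; decide +kernel)

end Disjointness

/-! ### Symbols of eigenvalue lists under merging -/

section PairSymbol

open scoped Classical in
/-- The Segre symbol of a multiset of Jordan blocks, given by dimension and eigenvalue. -/
noncomputable def pairSymbol (M : Multiset (ℕ × ℂ)) (τ : ℝ → Prop) : SegreSymbol :=
  (M.map Prod.snd).dedup.map fun c =>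
    ⟨eigenvalueKind τ c, (M.filter fun p => p.2 = c).map Prod.fst⟩

/-- Passing to multisets forgets the order of the blocks and allows them to be added one at a time.
-/
theorem symbolOf_eq_pairSymbol {n : ℕ} (r : Fin n → ℕ) (μ : Fin n → ℂ) (τ : ℝ → Prop) :
    symbolOf r μ τ = pairSymbol (Finset.univ.val.map fun i => (r i, μ i)) τ := by
  classical
  simp only [symbolOf, pairSymbol, Multiset.map_map, Multiset.filter_map, Finset.image_val,
    Function.comp_def, Finset.filter_val]

theorem eigenvalueKind_ofReal {τ : ℝ → Prop} {a : ℝ} (h : ¬ τ a) :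
    eigenvalueKind τ a = .real := by
  simp [eigenvalueKind, h]

theorem pairSymbol_zero (τ : ℝ → Prop) : pairSymbol 0 τ = 0 := by
  simp [pairSymbol]

theorem pairSymbol_cons_of_notMem {M : Multiset (ℕ × ℂ)} {τ : ℝ → Prop} {r : ℕ} {c : ℂ}
    (hc : c ∉ M.map Prod.snd) :
    pairSymbol ((r, c) ::ₘ M) τ = ⟨eigenvalueKind τ c, {r}⟩ ::ₘ pairSymbol M τ := by
  classical
  have h0 : M.filter (fun p => p.2 = c) = 0 := by
    rw [Multiset.filter_eq_nil]
    exact fun p hp h => hc (Multiset.mem_map.2 ⟨p, hp, h⟩)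
  rw [pairSymbol, Multiset.map_cons, Multiset.dedup_cons_of_notMem hc, Multiset.map_cons]
  congr 1
  · simp [h0]
  · refine Multiset.map_congr rfl fun d hd => ?_
    have hne : c ≠ d := by
      rintro rfl
      exact hc (Multiset.mem_dedup.1 hd)
    simp [hne]

/-- A repeated eigenvalue opens no new group: its digit joins the existing one. Compared with a
separate real group this is a single merging. -/
theorem pairSymbol_cons_of_mem {M : Multiset (ℕ × ℂ)} {τ : ℝ → Prop} {c : ℝ}
    (hc : (c : ℂ) ∈ M.map Prod.snd) :
    Brackets (⟨.real, {1}⟩ ::ₘ pairSymbol M τ) (pairSymbol ((1, (c : ℂ)) ::ₘ M) τ) := by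
  classical
  obtain ⟨D, hD⟩ := Multiset.exists_cons_of_mem (Multiset.mem_dedup.2 hc)
  have hcD : (c : ℂ) ∉ D := by
    have := Multiset.nodup_dedup (M.map Prod.snd)
    rw [hD] at this
    exact (Multiset.nodup_cons.1 this).1
  refine ⟨⟨eigenvalueKind τ c, (M.filter fun p => p.2 = (c : ℂ)).map Prod.fst⟩,
    ⟨.real, {1}⟩, D.map fun d => ⟨eigenvalueKind τ d, (M.filter fun p => p.2 = d).map Prod.fst⟩, ?_, rfl, ?_, ?_⟩
  · by_cases h : τ c <;> simp [eigenvalueKind, h]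
  · rw [Multiset.cons_swap, pairSymbol, hD, Multiset.map_cons]
  · rw [pairSymbol, Multiset.map_cons, Multiset.dedup_cons_of_mem hc, hD, Multiset.map_cons]
    congr 1
    · simp [add_comm]
    · refine Multiset.map_congr rfl fun d hd => ?_
      have hne : (c : ℂ) ≠ d := by
        rintro rfl
        exact hcD hd
      simp [hne]

theorem Brackets.cons {s s' : SegreSymbol} (h : Brackets s s') (G : SegreGroup) :
    Brackets (G ::ₘ s) (G ::ₘ s') := by
  obtain ⟨a, b, t, ha, hb, rfl, rfl⟩ := h
  refine ⟨a, b, G ::ₘ t, ha, hb, ?_, ?_⟩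
  · rw [Multiset.cons_swap G, Multiset.cons_swap G]
  · rw [Multiset.cons_swap]

theorem Brackets.reflTransGen_cons {s s' : SegreSymbol} (h : Relation.ReflTransGen Brackets s s')
    (G : SegreGroup) : Relation.ReflTransGen Brackets (G ::ₘ s) (G ::ₘ s') :=
  h.lift (G ::ₘ ·) (fun _ _ h => Brackets.cons h G)

theorem reflTransGen_pairSymbol_cons {s : SegreSymbol} {M : Multiset (ℕ × ℂ)} {τ : ℝ → Prop}
    (h : Relation.ReflTransGen Brackets s (pairSymbol M τ)) {c : ℝ}
    (hc : (c : ℂ) ∉ M.map Prod.snd → ¬ τ c) :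
    Relation.ReflTransGen Brackets (⟨.real, {1}⟩ ::ₘ s) (pairSymbol ((1, (c : ℂ)) ::ₘ M) τ) := by
  have h' := Brackets.reflTransGen_cons h ⟨.real, {1}⟩
  by_cases hm : (c : ℂ) ∈ M.map Prod.snd
  · exact h'.tail (pairSymbol_cons_of_mem hm)
  · rw [pairSymbol_cons_of_notMem hm, eigenvalueKind_ofReal (hc hm)]
    exact h'

/-- Letting two real eigenvalues become equal in the symbol of a list of Jordan blocks amounts to
letting them become equal in the list. -/
theorem Brackets.exists_map_eigenvalues {M : Multiset (ℕ × ℂ)} {τ : ℝ → Prop} {s' : SegreSymbol}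
    (h : Brackets (pairSymbol M τ) s') :
    ∃ (φ : ℂ → ℂ) (ψ : ℝ → ℝ), (∀ x : ℝ, φ x = ψ x) ∧ (∀ z : ℂ, z.im ≠ 0 → φ z = z) ∧
      (∀ x : ℝ, τ x → ψ x = x) ∧ s' = pairSymbol (M.map fun p => (p.1, φ p.2)) τ := by
  classical
  obtain ⟨G, H, t, hG, hH, hs, rfl⟩ := h
  obtain ⟨a, ha, rfl, ht⟩ := (Multiset.map_eq_cons _ _ _ _).2 hs
  obtain ⟨b, hb, rfl, ht'⟩ := (Multiset.map_eq_cons _ _ _ _).2 ht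
  obtain ⟨D, hD⟩ := Multiset.exists_cons_of_mem hb
  rw [hD, Multiset.erase_cons_head] at ht'
  have hD' : (M.map Prod.snd).dedup = a ::ₘ b ::ₘ D := by
    rw [← Multiset.cons_erase ha, hD]
  have hnd := Multiset.nodup_dedup (M.map Prod.snd)
  rw [hD', Multiset.nodup_cons, Multiset.nodup_cons, Multiset.mem_cons, not_or] at hnd
  obtain ⟨⟨hab, haD⟩, hbD, hDnd⟩ := hnd
  have hmem : ∀ c, (∃ p ∈ M, p.2 = c) ↔ c = a ∨ c = b ∨ c ∈ D := by
    intro c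
    rw [← Multiset.mem_map, ← Multiset.mem_dedup, hD']
    simp
  have haim : a.im = 0 := by
    simp only [eigenvalueKind] at hG
    split_ifs at hG with h1 h2 h3 <;> simp at hG
    · linarith
    · linarith
  have hbim : b.im = 0 ∧ ¬ τ b.re := by
    simp only [eigenvalueKind] at hH
    split_ifs at hH with h1 h2 h3
    exact ⟨by linarith, h3⟩
  have hare : ((a.re : ℝ) : ℂ) = a := Complex.ext rfl (by simp [haim])
  have hbre : ((b.re : ℝ) : ℂ) = b := Complex.ext rfl (by simp [hbim.1])
  -- The eigenvalue `b` is moved onto `a`, not conversely, since `a` may be the time-like one, which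
  -- has to stay fixed.
  refine ⟨fun z => if z = b then a else z, fun x => if x = b.re then a.re else x, ?_, ?_, ?_, ?_⟩
  · intro x
    have : (x : ℂ) = b ↔ x = b.re := by
      rw [← hbre, Complex.ofReal_inj, Complex.ofReal_re]
    by_cases hx : x = b.re
    · simp only [if_pos (this.2 hx), if_pos hx, hare]
    · simp only [if_neg (fun h => hx (this.1 h)), if_neg hx]
  · intro z hz
    refine if_neg ?_
    rintro rfl
    exact hz hbim.1
  · intro x hx
    refine if_neg ?_
    rintro rfl
    exact hbim.2 hx
  · have hdd : ((M.map fun p => (p.1, if p.2 = b then a else p.2)).map Prod.snd).dedup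
        = a ::ₘ D := by
      refine (Multiset.Nodup.ext (Multiset.nodup_dedup _)
        (Multiset.nodup_cons.2 ⟨haD, hDnd⟩)).2 fun c => ?_
      rw [Multiset.mem_dedup, Multiset.map_map, Multiset.mem_map, Multiset.mem_cons]
      constructor
      · rintro ⟨p, hp, rfl⟩
        simp only [Function.comp]
        split_ifs with h
        · exact Or.inl rfl
        · rcases (hmem _).1 ⟨p, hp, rfl⟩ with h' | h' | h'
          exacts [Or.inl h', absurd h' h, Or.inr h']
      · intro hc
        obtain ⟨p, hp, hpc⟩ := (hmem c).2 (hc.imp_right Or.inr)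
        refine ⟨p, hp, ?_⟩
        have hcb : c ≠ b := by
          rcases hc with rfl | hc
          · exact hab
          · rintro rfl; exact hbD hc
        simp [hpc, hcb]
    rw [pairSymbol, hdd, Multiset.map_cons, ← ht']
    have hab' : ¬ b = a := fun h => hab h.symm
    congr 1
    · congr 1
      rw [Multiset.filter_map, Multiset.map_map, ← Multiset.map_add, Multiset.filter_add_filter]
      have h0 : M.filter (fun p => p.2 = a ∧ p.2 = b) = 0 := by
        rw [Multiset.filter_eq_nil]
        rintro p - ⟨h1, h2⟩
        exact hab (h1.symm.trans h2)
      rw [h0, add_zero]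
      refine congrArg _ (Multiset.filter_congr fun p _ => ?_)
      by_cases h : p.2 = b <;> simp [h, hab']
    · refine Multiset.map_congr rfl fun c hc => ?_
      congr 1
      rw [Multiset.filter_map, Multiset.map_map]
      refine congrArg _ (Multiset.filter_congr fun p _ => ?_)
      have hca : ¬ a = c := by rintro rfl; exact haD hc
      have hcb : ¬ b = c := by rintro rfl; exact hbD hc
      by_cases h : p.2 = b <;> simp [h, hca, hcb]

end PairSymbol

/-! ### Symbols attained by the canonical forms -/

section Attained

/-- `s` is the symbol of the Jordan form of a canonical form of the type `F`. -/
def SegreClass.Attains (s : SegreSymbol) : SegreClass → Prop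
  | .type11111 => ∃ a b c d e : ℝ,
      s = pairSymbol {(1, (b : ℂ)), (1, (c : ℂ)), (1, (d : ℂ)), (1, (e : ℂ)), (1, (a : ℂ))} (· = a)
  | .type2111 => ∃ a c d e : ℝ,
      s = pairSymbol {(1, (c : ℂ)), (1, (d : ℂ)), (1, (e : ℂ)), (2, (a : ℂ))} (fun _ => False)
  | .type311 => ∃ a d e : ℝ,
      s = pairSymbol {(1, (d : ℂ)), (1, (e : ℂ)), (3, (a : ℂ))} (fun _ => False)
  | .typeZZ111 => ∃ a b c d e : ℝ, b ≠ 0 ∧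
      s = pairSymbol {(1, (c : ℂ)), (1, (d : ℂ)), (1, (e : ℂ)),
        (1, (a : ℂ) + b * Complex.I), (1, (a : ℂ) - b * Complex.I)} (fun _ => False)

theorem pairSymbol_singleton (r : ℕ) (c : ℂ) (τ : ℝ → Prop) :
    pairSymbol {(r, c)} τ = {⟨eigenvalueKind τ c, {r}⟩} := by
  rw [← Multiset.cons_zero, pairSymbol_cons_of_notMem (by simp), pairSymbol_zero,
    Multiset.cons_zero]

theorem pairSymbol_conj_pair {a b : ℝ} (hb : b ≠ 0) :
    pairSymbol {(1, (a : ℂ) + b * Complex.I), (1, (a : ℂ) - b * Complex.I)} (fun _ => False)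
      = {⟨.z, {1}⟩, ⟨.zbar, {1}⟩} := by
  have hne : (a : ℂ) + b * Complex.I ∉
      Multiset.map Prod.snd {(1, (a : ℂ) - b * Complex.I)} := by
    rw [Multiset.map_singleton, Multiset.mem_singleton]
    intro h
    have := congrArg Complex.im h
    simp at this
    exact hb (by linarith)
  rw [Multiset.insert_eq_cons, pairSymbol_cons_of_notMem hne, pairSymbol_singleton]
  rcases lt_or_gt_of_ne hb with h | h
  · simp only [eigenvalueKind, Complex.add_im, Complex.sub_im, Complex.ofReal_im, Complex.mul_im,
      Complex.ofReal_re, Complex.I_im, Complex.I_re, mul_one, mul_zero, add_zero, zero_add, zero_sub]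
    rw [if_neg h.not_gt, if_pos h, if_pos (by linarith)]
    decide +kernel
  · simp only [eigenvalueKind, Complex.add_im, Complex.sub_im, Complex.ofReal_im, Complex.mul_im,
      Complex.ofReal_re, Complex.I_im, Complex.I_re, mul_one, mul_zero, add_zero, zero_add, zero_sub]
    rw [if_pos h, if_neg (by linarith), if_pos (by linarith)]
    rfl

/-- Starting from the distinguished block or conjugate pair, simple real eigenvalues are added one
by one; each either opens the expected new group or costs one merging. -/
theorem SegreClass.Attains.reflTransGen {s : SegreSymbol} {F : SegreClass} (h : F.Attains s) :
    Relation.ReflTransGen Brackets F.symbol s := by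
  cases F with
  | type11111 =>
    obtain ⟨a, b, c, d, e, rfl⟩ := h
    have h0 : Relation.ReflTransGen Brackets {⟨.timelike, {1}⟩}
        (pairSymbol {(1, (a : ℂ))} (· = a)) := by
      rw [pairSymbol_singleton]
      simp [eigenvalueKind, Relation.ReflTransGen.refl]
    have h1 := reflTransGen_pairSymbol_cons h0 (c := e) (by simp)
    have h2 := reflTransGen_pairSymbol_cons h1 (c := d) (by simp)
    have h3 := reflTransGen_pairSymbol_cons h2 (c := c) (by simp)
    have h4 := reflTransGen_pairSymbol_cons h3 (c := b) (by simp)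
    convert h4 using 1
    · decide +kernel
    · rfl
  | type2111 =>
    obtain ⟨a, c, d, e, rfl⟩ := h
    have h0 : Relation.ReflTransGen Brackets {⟨.real, {2}⟩}
        (pairSymbol {(2, (a : ℂ))} (fun _ => False)) := by
      rw [pairSymbol_singleton]
      simp [eigenvalueKind, Relation.ReflTransGen.refl]
    have h1 := reflTransGen_pairSymbol_cons h0 (c := e) (by simp)
    have h2 := reflTransGen_pairSymbol_cons h1 (c := d) (by simp)
    have h3 := reflTransGen_pairSymbol_cons h2 (c := c) (by simp)
    convert h3 using 1
    · decide +kernel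
    · rfl
  | type311 =>
    obtain ⟨a, d, e, rfl⟩ := h
    have h0 : Relation.ReflTransGen Brackets {⟨.real, {3}⟩}
        (pairSymbol {(3, (a : ℂ))} (fun _ => False)) := by
      rw [pairSymbol_singleton]
      simp [eigenvalueKind, Relation.ReflTransGen.refl]
    have h1 := reflTransGen_pairSymbol_cons h0 (c := e) (by simp)
    have h2 := reflTransGen_pairSymbol_cons h1 (c := d) (by simp)
    convert h2 using 1
    · decide +kernel
    · rfl
  | typeZZ111 =>
    obtain ⟨a, b, c, d, e, hb, rfl⟩ := h
    have h0 : Relation.ReflTransGen Brackets {⟨.z, {1}⟩, ⟨.zbar, {1}⟩}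
        (pairSymbol {(1, (a : ℂ) + b * Complex.I), (1, (a : ℂ) - b * Complex.I)}
          (fun _ => False)) := by
      rw [pairSymbol_conj_pair hb]
    have h1 := reflTransGen_pairSymbol_cons h0 (c := e) (by simp)
    have h2 := reflTransGen_pairSymbol_cons h1 (c := d) (by simp)
    have h3 := reflTransGen_pairSymbol_cons h2 (c := c) (by simp)
    convert h3 using 1
    · decide +kernel
    · rfl

theorem pairSymbol_cons_real {M : Multiset (ℕ × ℂ)} {τ : ℝ → Prop} {c : ℝ}
    (hM : (c : ℂ) ∉ M.map Prod.snd) (hc : ¬ τ c) :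
    pairSymbol ((1, (c : ℂ)) ::ₘ M) τ = ⟨.real, {1}⟩ ::ₘ pairSymbol M τ := by
  rw [pairSymbol_cons_of_notMem hM, eigenvalueKind_ofReal hc]

theorem SegreClass.attains_symbol (F : SegreClass) : F.Attains F.symbol := by
  cases F with
  | type11111 =>
    refine ⟨0, 1, 2, 3, 4, ?_⟩
    simp only [Multiset.insert_eq_cons]
    rw [pairSymbol_cons_real (by norm_num) (by norm_num),
      pairSymbol_cons_real (by norm_num) (by norm_num),
      pairSymbol_cons_real (by norm_num) (by norm_num),
      pairSymbol_cons_real (by norm_num) (by norm_num), pairSymbol_singleton]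
    simp only [eigenvalueKind, Complex.ofReal_im, Complex.ofReal_re, lt_self_iff_false, if_false,
      if_true]
    decide +kernel
  | type2111 =>
    refine ⟨0, 1, 2, 3, ?_⟩
    simp only [Multiset.insert_eq_cons]
    rw [pairSymbol_cons_real (by norm_num) (by norm_num),
      pairSymbol_cons_real (by norm_num) (by norm_num),
      pairSymbol_cons_real (by norm_num) (by norm_num), pairSymbol_singleton,
      eigenvalueKind_ofReal (by norm_num)]
    decide +kernel
  | type311 =>
    refine ⟨0, 1, 2, ?_⟩
    simp only [Multiset.insert_eq_cons]
    rw [pairSymbol_cons_real (by norm_num) (by norm_num),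
      pairSymbol_cons_real (by norm_num) (by norm_num), pairSymbol_singleton,
      eigenvalueKind_ofReal (by norm_num)]
    decide +kernel
  | typeZZ111 =>
    refine ⟨0, 1, 1, 2, 3, one_ne_zero, ?_⟩
    have h := pairSymbol_conj_pair (a := 0) (b := 1) one_ne_zero
    simp only [Multiset.insert_eq_cons] at h ⊢
    rw [pairSymbol_cons_real (by simp [Complex.ext_iff]) (by norm_num),
      pairSymbol_cons_real (by simp [Complex.ext_iff]) (by norm_num),
      pairSymbol_cons_real (by simp [Complex.ext_iff]) (by norm_num), h]
    decide +kernel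

/-- A merging of groups is realised by changing the real eigenvalues; the time-like eigenvalue and
the conjugate pair are not moved. -/
theorem SegreClass.Attains.of_brackets {s s' : SegreSymbol} {F : SegreClass} (h : F.Attains s)
    (hs : Brackets s s') : F.Attains s' := by
  cases F with
  | type11111 =>
    obtain ⟨a, b, c, d, e, rfl⟩ := h
    obtain ⟨φ, ψ, hφ, -, hτ, rfl⟩ := hs.exists_map_eigenvalues
    exact ⟨a, ψ b, ψ c, ψ d, ψ e, by simp [hφ, hτ a rfl]⟩
  | type2111 =>
    obtain ⟨a, c, d, e, rfl⟩ := h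
    obtain ⟨φ, ψ, hφ, -, hτ, rfl⟩ := hs.exists_map_eigenvalues
    exact ⟨ψ a, ψ c, ψ d, ψ e, by simp [hφ]⟩
  | type311 =>
    obtain ⟨a, d, e, rfl⟩ := h
    obtain ⟨φ, ψ, hφ, -, hτ, rfl⟩ := hs.exists_map_eigenvalues
    exact ⟨ψ a, ψ d, ψ e, by simp [hφ]⟩
  | typeZZ111 =>
    obtain ⟨a, b, c, d, e, hb, rfl⟩ := h
    obtain ⟨φ, ψ, hφ, him, hτ, rfl⟩ := hs.exists_map_eigenvalues
    refine ⟨a, b, ψ c, ψ d, ψ e, hb, ?_⟩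
    have h1 := him ((a : ℂ) + b * Complex.I) (by simpa using hb)
    have h2 := him ((a : ℂ) - b * Complex.I) (by simpa using hb)
    simp [hφ, h1, h2]

theorem SegreClass.attains_iff {s : SegreSymbol} {F : SegreClass} :
    F.Attains s ↔ s = F.symbol ∨ F.IsDegeneracy s := by
  rw [← SegreClass.reflTransGen_iff]
  refine ⟨fun h => h.reflTransGen, fun h => ?_⟩
  induction h with
  | refl => exact F.attains_symbol
  | tail _ h ih => exact ih.of_brackets h

variable {V : Type*} [AddCommGroup V] [Module ℝ V] {g R : LinearMap.BilinForm ℝ V}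

/-- The canonical forms list the distinguished block first, `SegreClass.Attains` lists it last,
where an induction by `::ₘ` begins. -/
theorem cons_rotate_five {α : Type*} (a b c d e : α) :
    ({a, b, c, d, e} : Multiset α) = {b, c, d, e, a} := by
  simp only [Multiset.insert_eq_cons, ← Multiset.singleton_add]
  abel

theorem cons_rotate_four {α : Type*} (a b c d : α) :
    ({a, b, c, d} : Multiset α) = {b, c, d, a} := by
  simp only [Multiset.insert_eq_cons, ← Multiset.singleton_add]
  abel

theorem cons_rotate_three {α : Type*} (a b c : α) :
    ({a, b, c} : Multiset α) = {b, c, a} := by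
  simp only [Multiset.insert_eq_cons, ← Multiset.singleton_add]
  abel

theorem symbolOf_five (r : Fin 5 → ℕ) (μ : Fin 5 → ℂ) (τ : ℝ → Prop) :
    symbolOf r μ τ
      = pairSymbol {(r 0, μ 0), (r 1, μ 1), (r 2, μ 2), (r 3, μ 3), (r 4, μ 4)} τ := by
  rw [symbolOf_eq_pairSymbol]; rfl

theorem symbolOf_four (r : Fin 4 → ℕ) (μ : Fin 4 → ℂ) (τ : ℝ → Prop) :
    symbolOf r μ τ = pairSymbol {(r 0, μ 0), (r 1, μ 1), (r 2, μ 2), (r 3, μ 3)} τ := by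
  rw [symbolOf_eq_pairSymbol]; rfl

theorem symbolOf_three (r : Fin 3 → ℕ) (μ : Fin 3 → ℂ) (τ : ℝ → Prop) :
    symbolOf r μ τ = pairSymbol {(r 0, μ 0), (r 1, μ 1), (r 2, μ 2)} τ := by
  rw [symbolOf_eq_pairSymbol]; rfl

theorem HasCanonicalForm.attains {s : SegreSymbol} {F : SegreClass}
    (h : HasCanonicalForm g R s F) : F.Attains s := by
  cases F with
  | type11111 =>
    obtain ⟨-, ρ₁, ρ₂, ρ₃, ρ₄, ρ₅, -, rfl⟩ := h
    refine ⟨ρ₁ - ρ₂, ρ₁ + ρ₂, ρ₃, ρ₄, ρ₅, ?_⟩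
    rw [symbolOf_five, cons_rotate_five]
    simp
  | type2111 =>
    obtain ⟨-, -, ρ₁, ρ₃, ρ₄, ρ₅, -, -, rfl⟩ := h
    refine ⟨ρ₁, ρ₃, ρ₄, ρ₅, ?_⟩
    rw [symbolOf_four, cons_rotate_four]
    simp
  | type311 =>
    obtain ⟨-, ρ₁, ρ₄, ρ₅, -, rfl⟩ := h
    refine ⟨ρ₁, ρ₄, ρ₅, ?_⟩
    rw [symbolOf_three, cons_rotate_three]
    simp
  | typeZZ111 =>
    obtain ⟨-, ρ₁, ρ₂, ρ₃, ρ₄, ρ₅, h, -, rfl⟩ := h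
    refine ⟨ρ₁, ρ₂, ρ₃, ρ₄, ρ₅, h, ?_⟩
    rw [symbolOf_five, cons_rotate_five, cons_rotate_five]
    simp

theorem SegreClass.Attains.exists_form (P : SemiNullPentad g) {s : SegreSymbol} {F : SegreClass}
    (h : F.Attains s) : ∃ R, HasCanonicalForm g R s F := by
  cases F with
  | type11111 =>
    obtain ⟨a, b, c, d, e, rfl⟩ := h
    -- The solution of $\rho_1-\rho_2=a$, $\rho_1+\rho_2=b$.
    refine ⟨_, P, (a + b) / 2, (b - a) / 2, c, d, e, rfl, ?_⟩
    rw [symbolOf_five]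
    have h1 : (((a + b) / 2 : ℝ) : ℂ) - ((b - a) / 2 : ℝ) = a := by push_cast; ring
    have h2 : (((a + b) / 2 : ℝ) : ℂ) + ((b - a) / 2 : ℝ) = b := by push_cast; ring
    have h3 : (a + b) / 2 - (b - a) / 2 = a := by ring
    rw [h1, h2, h3]
    exact congrArg (fun M => pairSymbol M _) (cons_rotate_five _ _ _ _ _).symm
  | type2111 =>
    obtain ⟨a, c, d, e, rfl⟩ := h
    refine ⟨_, P, 1, a, c, d, e, Or.inl rfl, rfl, ?_⟩
    rw [symbolOf_four]
    exact congrArg (fun M => pairSymbol M _) (cons_rotate_four _ _ _ _).symm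
  | type311 =>
    obtain ⟨a, d, e, rfl⟩ := h
    refine ⟨_, P, a, d, e, rfl, ?_⟩
    rw [symbolOf_three]
    exact congrArg (fun M => pairSymbol M _) (cons_rotate_three _ _ _).symm
  | typeZZ111 =>
    obtain ⟨a, b, c, d, e, hb, rfl⟩ := h
    refine ⟨_, P, a, b, c, d, e, hb, rfl, ?_⟩
    rw [symbolOf_five]
    exact congrArg (fun M => pairSymbol M _)
      ((cons_rotate_five _ _ _ _ _).trans (cons_rotate_five _ _ _ _ _)).symm

theorem HasCanonicalForm.isSymm {s : SegreSymbol} {F : SegreClass}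
    (h : HasCanonicalForm g R s F) : R.IsSymm := by
  constructor
  intro u v
  cases F with
  | type11111 =>
    obtain ⟨P, ρ₁, ρ₂, ρ₃, ρ₄, ρ₅, rfl, -⟩ := h
    simp [symProd, prod]; ring
  | type2111 =>
    obtain ⟨P, ε, ρ₁, ρ₃, ρ₄, ρ₅, -, rfl, -⟩ := h
    simp [symProd, prod]; ring
  | type311 =>
    obtain ⟨P, ρ₁, ρ₄, ρ₅, rfl, -⟩ := h
    simp [symProd, prod]; ring
  | typeZZ111 =>
    obtain ⟨P, ρ₁, ρ₂, ρ₃, ρ₄, ρ₅, -, rfl, -⟩ := h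
    simp [symProd, prod]; ring

end Attained

/-! ### Uniqueness of the Jordan form -/

section JordanUniqueness

theorem jordanBlock_sub_scalar (r : ℕ) (c d : ℂ) :
    jordanBlock r c - d • (1 : Matrix (Fin r) (Fin r) ℂ) = jordanBlock r (c - d) := by
  ext i j
  simp only [jordanBlock, Matrix.sub_apply, Matrix.of_apply, Matrix.smul_apply, Matrix.one_apply,
    smul_eq_mul]
  by_cases h : i = j <;> simp [h]

theorem jordanBlock_zero_pow (r k : ℕ) :
    jordanBlock r 0 ^ k = Matrix.of fun i j : Fin r => if (i : ℕ) + k = j then (1 : ℂ) else 0 := by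
  induction k with
  | zero =>
    ext i j
    simp [Matrix.one_apply, Fin.ext_iff]
  | succ k ih =>
    ext i j
    rw [pow_succ, ih, Matrix.mul_apply]
    simp only [jordanBlock, Matrix.of_apply]
    by_cases h : (i : ℕ) + (k + 1) = j
    · have hk : (i : ℕ) + k < r := by omega
      rw [Finset.sum_eq_single ⟨i + k, hk⟩]
      · have : ¬ (⟨i + k, hk⟩ : Fin r) = j := by
          rw [Fin.ext_iff]
          change ¬ (i : ℕ) + k = j
          omega
        simp [this, h, add_assoc]
      · intro b _ hb
        have : ¬ (i : ℕ) + k = b := fun h' => hb (Fin.ext h'.symm)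
        simp [this]
      · simp
    · rw [if_neg h]
      refine Finset.sum_eq_zero fun b _ => ?_
      by_cases h1 : (i : ℕ) + k = b
      · have h2 : ¬ (b : ℕ) + 1 = j := by omega
        simp [h2]
      · simp [h1]

theorem det_jordanBlock (r : ℕ) (c : ℂ) : (jordanBlock r c).det = c ^ r := by
  rw [Matrix.det_of_isUpperTriangular]
  · simp [jordanBlock]
  · intro i j hij
    have h1 : ¬ i = j := fun h => by simp [h] at hij
    have h2 : ¬ (i : ℕ) + 1 = j := by
      have : (j : ℕ) < i := hij
      omega
    simp [jordanBlock, h1, h2]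

theorem finrank_ker_jordanBlock_pow (r k : ℕ) (c : ℂ) :
    Module.finrank ℂ (LinearMap.ker (jordanBlock r c ^ k).mulVecLin)
      = if c = 0 then min r k else 0 := by
  split_ifs with hc
  · subst hc
    let I : Set (Fin r) := {j | (j : ℕ) < k}
    let J : Set (Fin r) := {j | k ≤ (j : ℕ)}
    -- The $k$-th power of the nilpotent block shifts coordinates by $k$, so its kernel is where the
    -- coordinates from index $k$ on vanish.
    have hker : LinearMap.ker (jordanBlock r 0 ^ k).mulVecLin
        = ⨅ j ∈ J, LinearMap.ker (LinearMap.proj j : (Fin r → ℂ) →ₗ[ℂ] ℂ) := by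
      ext v
      simp only [LinearMap.mem_ker, Submodule.mem_iInf, LinearMap.proj_apply,
        Matrix.mulVecLin_apply, jordanBlock_zero_pow, funext_iff, Matrix.mulVec, dotProduct,
        Matrix.of_apply, Pi.zero_apply]
      constructor
      · intro h j hj
        have hj' : k ≤ (j : ℕ) := hj
        have := h ⟨j - k, by omega⟩
        rw [Finset.sum_eq_single j] at this
        · simpa [Nat.sub_add_cancel hj'] using this
        · intro b _ hb
          have : ¬ (j : ℕ) - k + k = b := fun h => hb (Fin.ext (by omega))
          simp [this]
        · simp
      · intro h i
        refine Finset.sum_eq_zero fun j _ => ?_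
        by_cases hij : (i : ℕ) + k = j
        · rw [h j (show k ≤ (j : ℕ) by omega), mul_zero]
        · simp [hij]
    have hd : Disjoint I J := Set.disjoint_left.2 fun j (h1 : (j : ℕ) < k) (h2 : k ≤ (j : ℕ)) => by
      omega
    have hu : Set.univ ⊆ I ∪ J := fun j _ => lt_or_ge (j : ℕ) k
    rw [hker, (LinearMap.iInfKerProjEquiv ℂ (fun _ => ℂ) hd hu).finrank_eq,
      Module.finrank_fintype_fun_eq_card, Fintype.card_subtype]
    exact Fin.card_filter_val_lt
  · have hdet : IsUnit (jordanBlock r c ^ k).det := by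
      rw [Matrix.det_pow, det_jordanBlock]
      exact (pow_ne_zero _ (pow_ne_zero _ hc)).isUnit
    have : LinearMap.ker (jordanBlock r c ^ k).mulVecLin = ⊥ := by
      rw [LinearMap.ker_eq_bot]
      exact Matrix.mulVec_injective_of_isUnit ((Matrix.isUnit_iff_isUnit_det _).2 hdet)
    rw [this, finrank_bot]

/-- The kernel of a block diagonal operator is the product of the kernels of the blocks. -/
theorem finrank_ker_of_toMatrix_eq_blockDiagonal' {W : Type*} [AddCommGroup W] [Module ℂ W]
    {n : ℕ} {r : Fin n → ℕ} (e : Module.Basis (Σ i : Fin n, Fin (r i)) ℂ W) (f : W →ₗ[ℂ] W)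
    (M : ∀ i, Matrix (Fin (r i)) (Fin (r i)) ℂ)
    (h : LinearMap.toMatrix e e f = Matrix.blockDiagonal' M) :
    Module.finrank ℂ (LinearMap.ker f)
      = ∑ i, Module.finrank ℂ (LinearMap.ker (M i).mulVecLin) := by
  have hrep : ∀ v i j, e.repr (f v) ⟨i, j⟩ = (M i).mulVec (fun j => e.repr v ⟨i, j⟩) j := by
    intro v i j
    have := congrFun (LinearMap.toMatrix_mulVec_repr e e f v) ⟨i, j⟩
    rw [← this, h]
    simp only [Matrix.mulVec, dotProduct, Fintype.sum_sigma, Matrix.blockDiagonal'_apply]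
    rw [Finset.sum_eq_single i]
    · simp
    · intro b _ hb
      simp [Ne.symm hb]
    · simp
  have hker : ∀ v, v ∈ LinearMap.ker f ↔
      ∀ i, (fun j => e.repr v ⟨i, j⟩) ∈ LinearMap.ker (M i).mulVecLin := by
    intro v
    rw [LinearMap.mem_ker, ← e.repr.map_eq_zero_iff]
    simp only [LinearMap.mem_ker, Matrix.mulVecLin_apply, funext_iff, ← hrep, Finsupp.ext_iff]
    exact ⟨fun h i j => h ⟨i, j⟩, fun h p => h p.1 p.2⟩
  let E : LinearMap.ker f ≃ₗ[ℂ] ∀ i, LinearMap.ker (M i).mulVecLin :=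
    { toFun := fun v i => ⟨fun j => e.repr v ⟨i, j⟩, (hker v).1 v.2 i⟩
      map_add' := fun v w => by ext; simp
      map_smul' := fun c v => by ext; simp
      invFun := fun y => ⟨e.equivFun.symm fun p => (y p.1).1 p.2, (hker _).2 fun i => by
        convert (y i).2 using 1
        ext j
        exact congrFun (e.equivFun.apply_symm_apply _) _⟩
      left_inv := fun v => by
        apply Subtype.ext
        exact e.equivFun.symm_apply_apply _
      right_inv := fun y => by
        ext i j
        exact congrFun (e.equivFun.apply_symm_apply _) _ }
  rw [E.finrank_eq, Module.finrank_pi_fintype]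

theorem finrank_ker_pow_of_jordan {W : Type*} [AddCommGroup W] [Module ℂ W]
    {n : ℕ} {r : Fin n → ℕ} {μ : Fin n → ℂ} (e : Module.Basis (Σ i : Fin n, Fin (r i)) ℂ W)
    (f : W →ₗ[ℂ] W)
    (h : LinearMap.toMatrix e e f = Matrix.blockDiagonal' fun i => jordanBlock (r i) (μ i))
    (c : ℂ) (k : ℕ) :
    Module.finrank ℂ (LinearMap.ker ((f - c • LinearMap.id) ^ k))
      = ∑ i, if μ i = c then min (r i) k else 0 := by
  have hsub : LinearMap.toMatrix e e (f - c • LinearMap.id)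
      = Matrix.blockDiagonal' fun i => jordanBlock (r i) (μ i - c) := by
    rw [map_sub, map_smul, LinearMap.toMatrix_id, h, ← Matrix.blockDiagonal'_one,
      ← Matrix.blockDiagonal'_smul, ← Matrix.blockDiagonal'_sub]
    congr 1
    ext1 i
    exact jordanBlock_sub_scalar _ _ _
  have hpow : LinearMap.toMatrix e e ((f - c • LinearMap.id) ^ k)
      = Matrix.blockDiagonal' fun i => jordanBlock (r i) (μ i - c) ^ k := by
    rw [← LinearMap.toMatrix_pow, hsub, ← Matrix.blockDiagonal'_pow]
    rfl
  rw [finrank_ker_of_toMatrix_eq_blockDiagonal' e _ _ hpow]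
  simp only [finrank_ker_jordanBlock_pow, sub_eq_zero]

/-- The first difference in $k$ of $\sum\min(a,k)$ counts the elements exceeding $k$, and the drop
between consecutive such counts is a multiplicity. Zeros contribute nothing and must be excluded. -/
theorem Multiset.eq_of_sum_min_eq {A B : Multiset ℕ} (hA : 0 ∉ A) (hB : 0 ∉ B)
    (h : ∀ k, (A.map fun a => min a k).sum = (B.map fun a => min a k).sum) : A = B := by
  have hsucc : ∀ (C : Multiset ℕ) (k : ℕ), (C.map fun a => min a (k + 1)).sum
      = (C.map fun a => min a k).sum + C.countP (k < ·) := by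
    intro C k
    induction C using Multiset.induction_on with
    | empty => simp
    | cons a C ih =>
      rw [Multiset.map_cons, Multiset.map_cons, Multiset.sum_cons, Multiset.sum_cons, ih,
        Multiset.countP_cons]
      split_ifs <;> omega
  have hcount : ∀ (C : Multiset ℕ) (k : ℕ), C.countP (k < ·)
      = C.countP (k + 1 < ·) + C.count (k + 1) := by
    intro C k
    induction C using Multiset.induction_on with
    | empty => simp
    | cons a C ih =>
      rw [Multiset.countP_cons, Multiset.countP_cons, Multiset.count_cons, ih]
      split_ifs <;> omega
  have hlt : ∀ k, A.countP (k < ·) = B.countP (k < ·) := by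
    intro k
    have h1 := h (k + 1)
    rw [hsucc, hsucc, h k] at h1
    omega
  ext d
  rcases d with _ | k
  · rw [Multiset.count_eq_zero_of_notMem hA, Multiset.count_eq_zero_of_notMem hB]
  · have h1 := hcount A k
    have h2 := hcount B k
    have h3 := hlt k
    have h4 := hlt (k + 1)
    omega

/-- For each $c$ the dimensions of $\ker(f-c)^k$ do not depend on the basis and recover the block
sizes at $c$. -/
theorem jordan_pairs_unique {W : Type*} [AddCommGroup W] [Module ℂ W] (f : W →ₗ[ℂ] W)
    {n n' : ℕ} {r : Fin n → ℕ} {μ : Fin n → ℂ} {r' : Fin n' → ℕ} {μ' : Fin n' → ℂ}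
    (e : Module.Basis (Σ i : Fin n, Fin (r i)) ℂ W) (e' : Module.Basis (Σ i : Fin n', Fin (r' i)) ℂ W)
    (hr : ∀ i, 0 < r i) (hr' : ∀ i, 0 < r' i)
    (h : LinearMap.toMatrix e e f = Matrix.blockDiagonal' fun i => jordanBlock (r i) (μ i))
    (h' : LinearMap.toMatrix e' e' f = Matrix.blockDiagonal' fun i => jordanBlock (r' i) (μ' i)) :
    Finset.univ.val.map (fun i => (r i, μ i)) = Finset.univ.val.map (fun i => (r' i, μ' i)) := by
  classical
  have hsum : ∀ {m : ℕ} (ρ : Fin m → ℕ) (ν : Fin m → ℂ) (c : ℂ) (k : ℕ),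
      ((((Finset.univ.val.map fun i => (ρ i, ν i)).filter fun p => p.2 = c).map Prod.fst).map
        fun a => min a k).sum = ∑ i, if ν i = c then min (ρ i) k else 0 := by
    intro m ρ ν c k
    rw [← Finset.sum_filter]
    simp only [Multiset.filter_map, Multiset.map_map, Finset.sum_eq_multiset_sum,
      Finset.filter_val, Function.comp_def]
  have hblocks : ∀ c : ℂ,
      (((Finset.univ.val.map fun i => (r i, μ i)).filter fun p => p.2 = c).map Prod.fst)
      = (((Finset.univ.val.map fun i => (r' i, μ' i)).filter fun p => p.2 = c).map Prod.fst) := by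
    intro c
    refine Multiset.eq_of_sum_min_eq ?_ ?_ fun k => ?_
    · simp only [Multiset.mem_map, Multiset.mem_filter]
      rintro ⟨p, ⟨⟨i, -, rfl⟩, -⟩, h0⟩
      exact (hr i).ne' h0
    · simp only [Multiset.mem_map, Multiset.mem_filter]
      rintro ⟨p, ⟨⟨i, -, rfl⟩, -⟩, h0⟩
      exact (hr' i).ne' h0
    · rw [hsum, hsum, ← finrank_ker_pow_of_jordan e f h, ← finrank_ker_pow_of_jordan e' f h']
  have hcount : ∀ (M : Multiset (ℕ × ℂ)) (d : ℕ) (c : ℂ),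
      M.count (d, c) = ((M.filter fun p => p.2 = c).map Prod.fst).count d := by
    intro M d c
    rw [Multiset.count_map, Multiset.filter_filter, Multiset.count, Multiset.countP_eq_card_filter]
    congr 1
    refine Multiset.filter_congr fun p _ => ?_
    rw [Prod.ext_iff, eq_comm (a := p.2)]
  ext ⟨d, c⟩
  rw [hcount, hcount, hblocks]

theorem HasSegreType.unique {V : Type*} [AddCommGroup V] [Module ℝ V] [FiniteDimensional ℝ V]
    {g : LinearMap.BilinForm ℝ V} {hg : IsLorentzian g} {R : LinearMap.BilinForm ℝ V}
    {s s' : SegreSymbol} (h : HasSegreType g hg R s) (h' : HasSegreType g hg R s') : s = s' := by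
  obtain ⟨n, r, μ, e, hr, hM, rfl⟩ := h
  obtain ⟨n', r', μ', e', hr', hM', rfl⟩ := h'
  rw [symbolOf_eq_pairSymbol, symbolOf_eq_pairSymbol, jordan_pairs_unique _ e e' hr hr' hM hM']

end JordanUniqueness

/-! ### The Segre type of each canonical form -/

section SegreTypeOfCanonicalForm

variable {V : Type*} [AddCommGroup V] [Module ℝ V] {g : LinearMap.BilinForm ℝ V}

/-- Five spanning vectors form a basis by dimension. Each chain starts with an eigenvector and its
later members map to the previous one, matching ones above the diagonal; values of `F i` from `r i`
on are irrelevant. -/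
theorem hasSegreType_of_jordan_chains [FiniteDimensional ℝ V] (hg : IsLorentzian g) (R : LinearMap.BilinForm ℝ V)
    (P : SemiNullPentad g) {n : ℕ} (r : Fin n → ℕ) (μ : Fin n → ℂ) (F : Fin n → ℕ → ℂ ⊗[ℝ] V)
    (hr : ∀ i, 0 < r i) (hsum : ∑ i, r i = 5)
    (hspan : ∀ k, (1 : ℂ) ⊗ₜ[ℝ] P.basis k ∈
      Submodule.span ℂ {w | ∃ i, ∃ j < r i, F i j = w})
    (hF : ∀ i, ∀ j < r i, (mixed g hg R).baseChange ℂ (F i j)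
      = μ i • F i j + if j = 0 then 0 else F i (j - 1)) :
    HasSegreType g hg R (symbolOf r μ fun c => ∃ v : V, g v v < 0 ∧ mixed g hg R v = c • v) := by
  let f : (Σ i : Fin n, Fin (r i)) → ℂ ⊗[ℝ] V := fun p => F p.1 p.2
  have hrange : Set.range f = {w | ∃ i, ∃ j < r i, F i j = w} := by
    ext w
    constructor
    · rintro ⟨⟨i, j⟩, rfl⟩
      exact ⟨i, j, j.2, rfl⟩
    · rintro ⟨i, j, hj, rfl⟩
      exact ⟨⟨i, ⟨j, hj⟩⟩, rfl⟩
  have htop : ⊤ ≤ Submodule.span ℂ (Set.range f) := by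
    rw [← (P.basis.baseChange ℂ).span_eq, Submodule.span_le]
    rintro _ ⟨k, rfl⟩
    rw [Module.Basis.baseChange_apply, hrange]
    exact hspan k
  have hcard : Fintype.card (Σ i : Fin n, Fin (r i)) = Module.finrank ℂ (ℂ ⊗[ℝ] V) := by
    rw [Module.finrank_baseChange, hg.finrank_eq, Fintype.card_sigma]
    simpa using hsum
  let e := basisOfTopLeSpanOfCardEqFinrank f htop hcard
  have he : ∀ p, e p = f p := fun p => by
    simp [e]
  refine ⟨n, r, μ, e, hr, ?_, rfl⟩
  ext ⟨i, j⟩ ⟨i', j'⟩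
  rw [LinearMap.toMatrix_apply, he]
  have h1 : (mixed g hg R).baseChange ℂ (f ⟨i', j'⟩)
      = μ i' • e ⟨i', j'⟩ + if h : (j' : ℕ) = 0 then 0 else e ⟨i', ⟨j' - 1, by omega⟩⟩ := by
    rw [he]
    refine (hF i' j' j'.2).trans ?_
    split_ifs with h
    · rfl
    · rw [he]
  rw [h1, map_add, map_smul, Finsupp.add_apply, Finsupp.smul_apply, Module.Basis.repr_self,
    Matrix.blockDiagonal'_apply]
  by_cases hi : i = i'
  · subst hi
    simp only [dite_true, cast_eq, jordanBlock, Matrix.of_apply, Finsupp.single_apply,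
      Sigma.mk.injEq, heq_eq_eq, true_and, smul_eq_mul]
    by_cases hj0 : (j' : ℕ) = 0
    · have h3 : ¬ (j : ℕ) + 1 = j' := by omega
      by_cases hj : j' = j
      · simp [hj]
        simp [← hj, hj0]
      · simp [hj0, hj, Ne.symm hj]
    · rw [dif_neg hj0, Module.Basis.repr_self, Finsupp.single_apply]
      simp only [Sigma.mk.injEq, heq_eq_eq, true_and, Fin.ext_iff]
      by_cases hj : (j' : ℕ) = j
      · have h3 : ¬ (j' : ℕ) - 1 = j := by omega
        rw [if_pos hj, if_neg h3, if_pos hj.symm, mul_one, add_zero]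
      · by_cases h3 : (j : ℕ) + 1 = j'
        · have h4 : (j' : ℕ) - 1 = j := by omega
          simp [hj, Ne.symm hj, h3, h4]
        · have h4 : ¬ (j' : ℕ) - 1 = j := by omega
          simp [hj, Ne.symm hj, h3, h4]
  · rw [dif_neg hi]
    have hi' : ¬ i' = i := Ne.symm hi
    split_ifs with h
    · simp [hi']
    · rw [Module.Basis.repr_self]
      simp [hi']

theorem one_tmul_smul (c : ℝ) (v : V) :
    (1 : ℂ) ⊗ₜ[ℝ] (c • v) = (c : ℂ) • ((1 : ℂ) ⊗ₜ[ℝ] v) := by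
  rw [TensorProduct.tmul_smul, TensorProduct.smul_tmul', TensorProduct.smul_tmul']
  simp

/-- The trailing `if` reproduces the chain hypothesis of `hasSegreType_of_jordan_chains` at `j = 0`.
-/
theorem baseChange_eigenvector {T : V →ₗ[ℝ] V} {v : V} {c : ℝ} (h : T v = c • v) {μ : ℂ}
    (hμ : μ = c) (w : ℂ ⊗[ℝ] V) : T.baseChange ℂ ((1 : ℂ) ⊗ₜ[ℝ] v)
      = μ • ((1 : ℂ) ⊗ₜ[ℝ] v) + if (0 : ℕ) = 0 then 0 else w := by
  rw [LinearMap.baseChange_tmul, h, one_tmul_smul, hμ, if_pos rfl, add_zero]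

theorem baseChange_chain {T : V →ₗ[ℝ] V} {v w : V} {c : ℝ} (h : T v = c • v + w) (j : ℕ) :
    T.baseChange ℂ ((1 : ℂ) ⊗ₜ[ℝ] v)
      = (c : ℂ) • ((1 : ℂ) ⊗ₜ[ℝ] v) + if j + 1 = 0 then 0 else (1 : ℂ) ⊗ₜ[ℝ] w := by
  rw [LinearMap.baseChange_tmul, h, TensorProduct.tmul_add, one_tmul_smul, if_neg (by omega)]

theorem IsLorentzian.not_timelike_of_orthogonal (hg : IsLorentzian g) {u v : V} (hu : u ≠ 0)
    (huu : g u u ≤ 0) (huv : g u v = 0) : ¬ g v v < 0 :=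
  not_lt.2 (hg.nonneg_of_orthogonal hu huu huv).1

theorem span_mem_of_chain {n : ℕ} {r : Fin n → ℕ} {F : Fin n → ℕ → ℂ ⊗[ℝ] V} (i : Fin n) (j : ℕ)
    (hj : j < r i) : F i j ∈ Submodule.span ℂ {w | ∃ i, ∃ j < r i, F i j = w} :=
  Submodule.subset_span ⟨i, j, hj, rfl⟩

theorem HasCanonicalForm.hasSegreType [FiniteDimensional ℝ V] (hg : IsLorentzian g)
    {R : LinearMap.BilinForm ℝ V}
    {s : SegreSymbol} {F : SegreClass} (h : HasCanonicalForm g R s F) :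
    HasSegreType g hg R s := by
  have hR := h.isSymm
  have hT := mixed_selfAdjoint hg hR
  cases F with
  | type11111 =>
    obtain ⟨P, ρ₁, ρ₂, ρ₃, ρ₄, ρ₅, hRdef, rfl⟩ := h
    have hTv : ∀ v, mixed g hg R v = ρ₁ • (g P.l v • P.m + g P.m v • P.l)
        + ρ₂ • (g P.l v • P.l + g P.m v • P.m) + ρ₃ • g P.x v • P.x + ρ₄ • g P.y v • P.y
        + ρ₅ • g P.z v • P.z := fun v => by
      simp only [hRdef, mixed_add, mixed_smul, mixed_symProd, mixed_prod]
    have hl : mixed g hg R P.l = ρ₁ • P.l + ρ₂ • P.m := by rw [hTv]; simp [P.gram]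
    have hm : mixed g hg R P.m = ρ₁ • P.m + ρ₂ • P.l := by rw [hTv]; simp [P.gram]
    have hx : mixed g hg R P.x = ρ₃ • P.x := by rw [hTv]; simp [P.gram]
    have hy : mixed g hg R P.y = ρ₄ • P.y := by rw [hTv]; simp [P.gram]
    have hz : mixed g hg R P.z = ρ₅ • P.z := by rw [hTv]; simp [P.gram]
    have htt : g (P.l - P.m) (P.l - P.m) < 0 := by simp [P.gram]
    have hTt : mixed g hg R (P.l - P.m) = (ρ₁ - ρ₂) • (P.l - P.m) := by
      rw [map_sub, hl, hm]; module
    have hτ : (fun c : ℝ => c = ρ₁ - ρ₂)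
        = fun c => ∃ v : V, g v v < 0 ∧ mixed g hg R v = c • v := by
      funext c
      refine propext ⟨?_, ?_⟩
      · rintro rfl
        exact ⟨_, htt, hTt⟩
      · rintro ⟨v, hv, hc⟩
        -- Eigenvectors of different eigenvalues are orthogonal, but two time-like vectors never
        -- are.
        by_contra hne
        have h1 := hT (P.l - P.m) v
        rw [hTt, hc, map_smul, map_smul, LinearMap.smul_apply, smul_eq_mul, smul_eq_mul] at h1
        have h2 : (c - (ρ₁ - ρ₂)) * g (P.l - P.m) v = 0 := by linarith
        have h3 := (mul_eq_zero.1 h2).resolve_left (sub_ne_zero.2 hne)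
        refine hg.not_timelike_of_orthogonal ?_ htt.le h3 hv
        intro h0
        rw [h0] at htt
        simp at htt
    rw [hτ]
    have hspan := fun i j => span_mem_of_chain (r := ![1, 1, 1, 1, 1])
      (F := ![fun _ => (1 : ℂ) ⊗ₜ[ℝ] (P.l - P.m), fun _ => (1 : ℂ) ⊗ₜ[ℝ] (P.l + P.m),
        fun _ => (1 : ℂ) ⊗ₜ[ℝ] P.x, fun _ => (1 : ℂ) ⊗ₜ[ℝ] P.y, fun _ => (1 : ℂ) ⊗ₜ[ℝ] P.z]) i j
    refine hasSegreType_of_jordan_chains hg R P ![1, 1, 1, 1, 1] _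
      ![fun _ => (1 : ℂ) ⊗ₜ[ℝ] (P.l - P.m), fun _ => (1 : ℂ) ⊗ₜ[ℝ] (P.l + P.m),
        fun _ => (1 : ℂ) ⊗ₜ[ℝ] P.x, fun _ => (1 : ℂ) ⊗ₜ[ℝ] P.y, fun _ => (1 : ℂ) ⊗ₜ[ℝ] P.z]
      ?_ ?_ ?_ ?_
    · intro i; fin_cases i <;> simp
    · simp [Fin.sum_univ_succ]
    · intro k
      have h0 := hspan 0 0 (by simp)
      have h1 := hspan 1 0 (by simp)
      fin_cases k
      · have : (1 : ℂ) ⊗ₜ[ℝ] P.l = (1 / 2 : ℂ) • ((1 : ℂ) ⊗ₜ[ℝ] (P.l - P.m))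
            + (1 / 2 : ℂ) • ((1 : ℂ) ⊗ₜ[ℝ] (P.l + P.m)) := by
          rw [TensorProduct.tmul_sub, TensorProduct.tmul_add]; module
        exact Set.mem_of_eq_of_mem this
          (Submodule.add_mem _ (Submodule.smul_mem _ _ h0) (Submodule.smul_mem _ _ h1))
      · have : (1 : ℂ) ⊗ₜ[ℝ] P.m = (-1 / 2 : ℂ) • ((1 : ℂ) ⊗ₜ[ℝ] (P.l - P.m))
            + (1 / 2 : ℂ) • ((1 : ℂ) ⊗ₜ[ℝ] (P.l + P.m)) := by
          rw [TensorProduct.tmul_sub, TensorProduct.tmul_add]; module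
        exact Set.mem_of_eq_of_mem this
          (Submodule.add_mem _ (Submodule.smul_mem _ _ h0) (Submodule.smul_mem _ _ h1))
      · exact hspan 2 0 (by simp)
      · exact hspan 3 0 (by simp)
      · exact hspan 4 0 (by simp)
    · have hTs : mixed g hg R (P.l + P.m) = (ρ₁ + ρ₂) • (P.l + P.m) := by
        rw [map_add, hl, hm]; module
      intro i j hj
      fin_cases i <;> obtain rfl : j = 0 := Nat.lt_one_iff.1 hj
      · exact baseChange_eigenvector hTt (by push_cast; rfl) _
      · exact baseChange_eigenvector hTs (by push_cast; rfl) _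
      · exact baseChange_eigenvector hx rfl _
      · exact baseChange_eigenvector hy rfl _
      · exact baseChange_eigenvector hz rfl _
  | type2111 =>
    obtain ⟨P, ε, ρ₁, ρ₃, ρ₄, ρ₅, hε, hRdef, rfl⟩ := h
    have hTv : ∀ v, mixed g hg R v = ρ₁ • (g P.l v • P.m + g P.m v • P.l)
        + ε • g P.l v • P.l + ρ₃ • g P.x v • P.x + ρ₄ • g P.y v • P.y
        + ρ₅ • g P.z v • P.z := fun v => by
      simp only [hRdef, mixed_add, mixed_smul, mixed_symProd, mixed_prod]
    have hl : mixed g hg R P.l = ρ₁ • P.l := by rw [hTv]; simp [P.gram]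
    have hm : mixed g hg R P.m = ρ₁ • P.m + ε • P.l := by rw [hTv]; simp [P.gram]
    have hx : mixed g hg R P.x = ρ₃ • P.x := by rw [hTv]; simp [P.gram]
    have hy : mixed g hg R P.y = ρ₄ • P.y := by rw [hTv]; simp [P.gram]
    have hz : mixed g hg R P.z = ρ₅ • P.z := by rw [hTv]; simp [P.gram]
    have hε0 : ε ≠ 0 := by rcases hε with rfl | rfl <;> norm_num
    have hτ : (fun _ : ℝ => False) = fun c => ∃ v : V, g v v < 0 ∧ mixed g hg R v = c • v := by
      funext c
      refine propext ⟨False.elim, ?_⟩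
      rintro ⟨v, hv, hc⟩
      -- Every real eigenvector is orthogonal to the null vector `l`, hence not time-like: by
      -- self-adjointness against `l` if $c\ne\rho_1$, against `m` otherwise.
      refine hg.not_timelike_of_orthogonal (P.basis.ne_zero 0) P.gram.1.1.le ?_ hv
      change g P.l v = 0
      have h1 := hT P.l v
      have h2 := hT P.m v
      rw [hl, hc, map_smul, map_smul, LinearMap.smul_apply, smul_eq_mul, smul_eq_mul] at h1
      rw [hm, hc, map_add, map_smul, map_smul, map_smul, LinearMap.add_apply, LinearMap.smul_apply,
        LinearMap.smul_apply, smul_eq_mul, smul_eq_mul, smul_eq_mul] at h2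
      by_cases hne : c = ρ₁
      · subst hne
        have : ε * g P.l v = 0 := by linarith
        exact (mul_eq_zero.1 this).resolve_left hε0
      · have h3 : (c - ρ₁) * g P.l v = 0 := by linarith
        exact (mul_eq_zero.1 h3).resolve_left (sub_ne_zero.2 hne)
    rw [hτ]
    have hspan := fun i j => span_mem_of_chain (r := ![2, 1, 1, 1])
      -- The factor `ε` on the first chain vector makes the superdiagonal entry $1$ for either sign.
      (F := ![fun j => if j = 0 then (1 : ℂ) ⊗ₜ[ℝ] (ε • P.l) else (1 : ℂ) ⊗ₜ[ℝ] P.m,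
        fun _ => (1 : ℂ) ⊗ₜ[ℝ] P.x, fun _ => (1 : ℂ) ⊗ₜ[ℝ] P.y, fun _ => (1 : ℂ) ⊗ₜ[ℝ] P.z]) i j
    refine hasSegreType_of_jordan_chains hg R P ![2, 1, 1, 1] _
      ![fun j => if j = 0 then (1 : ℂ) ⊗ₜ[ℝ] (ε • P.l) else (1 : ℂ) ⊗ₜ[ℝ] P.m,
        fun _ => (1 : ℂ) ⊗ₜ[ℝ] P.x, fun _ => (1 : ℂ) ⊗ₜ[ℝ] P.y, fun _ => (1 : ℂ) ⊗ₜ[ℝ] P.z]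
      ?_ ?_ ?_ ?_
    · intro i; fin_cases i <;> simp
    · simp [Fin.sum_univ_succ]
    · intro k
      fin_cases k
      · have h0 := hspan 0 0 (by simp)
        have : (1 : ℂ) ⊗ₜ[ℝ] P.l = (ε : ℂ)⁻¹ • ((1 : ℂ) ⊗ₜ[ℝ] (ε • P.l)) := by
          rw [one_tmul_smul, smul_smul, inv_mul_cancel₀ (Complex.ofReal_ne_zero.2 hε0), one_smul]
        exact Set.mem_of_eq_of_mem this (Submodule.smul_mem _ _ h0)
      · exact hspan 0 1 (by simp)
      · exact hspan 1 0 (by simp)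
      · exact hspan 2 0 (by simp)
      · exact hspan 3 0 (by simp)
    · intro i j hj
      fin_cases i
      · have hj2 : j < 2 := hj
        interval_cases j
        · exact baseChange_eigenvector (by rw [map_smul, hl, smul_comm]) rfl _
        · exact baseChange_chain hm 0
      all_goals obtain rfl : j = 0 := Nat.lt_one_iff.1 hj
      · exact baseChange_eigenvector hx rfl _
      · exact baseChange_eigenvector hy rfl _
      · exact baseChange_eigenvector hz rfl _
  | type311 =>
    obtain ⟨P, ρ₁, ρ₄, ρ₅, hRdef, rfl⟩ := h
    have hTv : ∀ v, mixed g hg R v = ρ₁ • (g P.l v • P.m + g P.m v • P.l)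
        + (g P.l v • P.x + g P.x v • P.l) + ρ₁ • g P.x v • P.x + ρ₄ • g P.y v • P.y
        + ρ₅ • g P.z v • P.z := fun v => by
      simp only [hRdef, mixed_add, mixed_smul, mixed_symProd, mixed_prod]
    have hl : mixed g hg R P.l = ρ₁ • P.l := by rw [hTv]; simp [P.gram]
    have hm : mixed g hg R P.m = ρ₁ • P.m + P.x := by rw [hTv]; simp [P.gram]
    have hx : mixed g hg R P.x = ρ₁ • P.x + P.l := by rw [hTv]; simp [P.gram, add_comm]
    have hy : mixed g hg R P.y = ρ₄ • P.y := by rw [hTv]; simp [P.gram]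
    have hz : mixed g hg R P.z = ρ₅ • P.z := by rw [hTv]; simp [P.gram]
    have hτ : (fun _ : ℝ => False) = fun c => ∃ v : V, g v v < 0 ∧ mixed g hg R v = c • v := by
      funext c
      refine propext ⟨False.elim, ?_⟩
      rintro ⟨v, hv, hc⟩
      refine hg.not_timelike_of_orthogonal (P.basis.ne_zero 0) P.gram.1.1.le ?_ hv
      change g P.l v = 0
      have h1 := hT P.l v
      have h2 := hT P.x v
      rw [hl, hc, map_smul, map_smul, LinearMap.smul_apply, smul_eq_mul, smul_eq_mul] at h1
      rw [hx, hc, map_add, map_smul, map_smul, LinearMap.add_apply, LinearMap.smul_apply,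
        smul_eq_mul, smul_eq_mul] at h2
      by_cases hne : c = ρ₁
      · subst hne
        linarith
      · have h3 : (c - ρ₁) * g P.l v = 0 := by linarith
        exact (mul_eq_zero.1 h3).resolve_left (sub_ne_zero.2 hne)
    rw [hτ]
    have hspan := fun i j => span_mem_of_chain (r := ![3, 1, 1])
      (F := ![fun j => if j = 0 then (1 : ℂ) ⊗ₜ[ℝ] P.l else if j = 1 then (1 : ℂ) ⊗ₜ[ℝ] P.x
          else (1 : ℂ) ⊗ₜ[ℝ] P.m,
        fun _ => (1 : ℂ) ⊗ₜ[ℝ] P.y, fun _ => (1 : ℂ) ⊗ₜ[ℝ] P.z]) i j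
    refine hasSegreType_of_jordan_chains hg R P ![3, 1, 1] _
      ![fun j => if j = 0 then (1 : ℂ) ⊗ₜ[ℝ] P.l else if j = 1 then (1 : ℂ) ⊗ₜ[ℝ] P.x
          else (1 : ℂ) ⊗ₜ[ℝ] P.m,
        fun _ => (1 : ℂ) ⊗ₜ[ℝ] P.y, fun _ => (1 : ℂ) ⊗ₜ[ℝ] P.z]
      ?_ ?_ ?_ ?_
    · intro i; fin_cases i <;> simp
    · simp [Fin.sum_univ_succ]
    · intro k
      fin_cases k
      · exact hspan 0 0 (by simp)
      · exact hspan 0 2 (by simp)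
      · exact hspan 0 1 (by simp)
      · exact hspan 1 0 (by simp)
      · exact hspan 2 0 (by simp)
    · intro i j hj
      fin_cases i
      · have hj3 : j < 3 := hj
        interval_cases j
        · exact baseChange_eigenvector hl rfl _
        · exact baseChange_chain hx 0
        · exact baseChange_chain hm 1
      all_goals obtain rfl : j = 0 := Nat.lt_one_iff.1 hj
      · exact baseChange_eigenvector hy rfl _
      · exact baseChange_eigenvector hz rfl _
  | typeZZ111 =>
    obtain ⟨P, ρ₁, ρ₂, ρ₃, ρ₄, ρ₅, hρ, hRdef, rfl⟩ := h
    have hTv : ∀ v, mixed g hg R v = ρ₁ • (g P.l v • P.m + g P.m v • P.l)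
        + ρ₂ • (g P.l v • P.l - g P.m v • P.m) + ρ₃ • g P.x v • P.x + ρ₄ • g P.y v • P.y
        + ρ₅ • g P.z v • P.z := fun v => by
      simp only [hRdef, mixed_add, mixed_sub, mixed_smul, mixed_symProd, mixed_prod]
    have hl : mixed g hg R P.l = ρ₁ • P.l - ρ₂ • P.m := by
      rw [hTv]; simp [P.gram, sub_eq_add_neg]
    have hm : mixed g hg R P.m = ρ₁ • P.m + ρ₂ • P.l := by rw [hTv]; simp [P.gram]
    have hx : mixed g hg R P.x = ρ₃ • P.x := by rw [hTv]; simp [P.gram]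
    have hy : mixed g hg R P.y = ρ₄ • P.y := by rw [hTv]; simp [P.gram]
    have hz : mixed g hg R P.z = ρ₅ • P.z := by rw [hTv]; simp [P.gram]
    have hτ : (fun _ : ℝ => False) = fun c => ∃ v : V, g v v < 0 ∧ mixed g hg R v = c • v := by
      funext c
      refine propext ⟨False.elim, ?_⟩
      rintro ⟨v, hv, hc⟩
      refine hg.not_timelike_of_orthogonal (P.basis.ne_zero 0) P.gram.1.1.le ?_ hv
      change g P.l v = 0
      have h1 := hT P.l v
      have h2 := hT P.m v
      rw [hl, hc, map_sub, map_smul, map_smul, map_smul, LinearMap.sub_apply, LinearMap.smul_apply,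
        LinearMap.smul_apply, smul_eq_mul, smul_eq_mul, smul_eq_mul] at h1
      rw [hm, hc, map_add, map_smul, map_smul, map_smul, LinearMap.add_apply, LinearMap.smul_apply,
        LinearMap.smul_apply, smul_eq_mul, smul_eq_mul, smul_eq_mul] at h2
      -- Eliminating $g(m,v)$ from the two relations; the factor is positive because $\rho_2\ne0$.
      have h3 : ((c - ρ₁) ^ 2 + ρ₂ ^ 2) * g P.l v = 0 := by
        linear_combination (ρ₁ - c) * h1 + ρ₂ * h2
      refine (mul_eq_zero.1 h3).resolve_left ?_
      have := pow_pos (abs_pos.2 hρ) 2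
      rw [sq_abs] at this
      positivity
    rw [hτ]
    have hspan := fun i j => span_mem_of_chain (r := ![1, 1, 1, 1, 1])
      -- The eigenvectors are $m\mp il$ for $\rho_1\pm i\rho_2$.
      (F := ![fun _ => (1 : ℂ) ⊗ₜ[ℝ] P.m - Complex.I • ((1 : ℂ) ⊗ₜ[ℝ] P.l),
        fun _ => (1 : ℂ) ⊗ₜ[ℝ] P.m + Complex.I • ((1 : ℂ) ⊗ₜ[ℝ] P.l),
        fun _ => (1 : ℂ) ⊗ₜ[ℝ] P.x, fun _ => (1 : ℂ) ⊗ₜ[ℝ] P.y, fun _ => (1 : ℂ) ⊗ₜ[ℝ] P.z]) i j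
    refine hasSegreType_of_jordan_chains hg R P ![1, 1, 1, 1, 1] _
      ![fun _ => (1 : ℂ) ⊗ₜ[ℝ] P.m - Complex.I • ((1 : ℂ) ⊗ₜ[ℝ] P.l),
        fun _ => (1 : ℂ) ⊗ₜ[ℝ] P.m + Complex.I • ((1 : ℂ) ⊗ₜ[ℝ] P.l),
        fun _ => (1 : ℂ) ⊗ₜ[ℝ] P.x, fun _ => (1 : ℂ) ⊗ₜ[ℝ] P.y, fun _ => (1 : ℂ) ⊗ₜ[ℝ] P.z]
      ?_ ?_ ?_ ?_
    · intro i; fin_cases i <;> simp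
    · simp [Fin.sum_univ_succ]
    · intro k
      have h0 := hspan 0 0 (by simp)
      have h1 := hspan 1 0 (by simp)
      fin_cases k
      · have : (1 : ℂ) ⊗ₜ[ℝ] P.l
            = (Complex.I / 2) • ((1 : ℂ) ⊗ₜ[ℝ] P.m - Complex.I • ((1 : ℂ) ⊗ₜ[ℝ] P.l))
            + (-Complex.I / 2) • ((1 : ℂ) ⊗ₜ[ℝ] P.m + Complex.I • ((1 : ℂ) ⊗ₜ[ℝ] P.l)) := by
          match_scalars
          · linear_combination Complex.I_mul_I
          · ring
        exact Set.mem_of_eq_of_mem this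
          (Submodule.add_mem _ (Submodule.smul_mem _ _ h0) (Submodule.smul_mem _ _ h1))
      · have : (1 : ℂ) ⊗ₜ[ℝ] P.m
            = (1 / 2 : ℂ) • ((1 : ℂ) ⊗ₜ[ℝ] P.m - Complex.I • ((1 : ℂ) ⊗ₜ[ℝ] P.l))
            + (1 / 2 : ℂ) • ((1 : ℂ) ⊗ₜ[ℝ] P.m + Complex.I • ((1 : ℂ) ⊗ₜ[ℝ] P.l)) := by
          module
        exact Set.mem_of_eq_of_mem this
          (Submodule.add_mem _ (Submodule.smul_mem _ _ h0) (Submodule.smul_mem _ _ h1))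
      · exact hspan 2 0 (by simp)
      · exact hspan 3 0 (by simp)
      · exact hspan 4 0 (by simp)
    · have hml : (mixed g hg R).baseChange ℂ ((1 : ℂ) ⊗ₜ[ℝ] P.l)
          = (ρ₁ : ℂ) • ((1 : ℂ) ⊗ₜ[ℝ] P.l) - (ρ₂ : ℂ) • ((1 : ℂ) ⊗ₜ[ℝ] P.m) := by
        rw [LinearMap.baseChange_tmul, hl, TensorProduct.tmul_sub, one_tmul_smul, one_tmul_smul]
      have hmm : (mixed g hg R).baseChange ℂ ((1 : ℂ) ⊗ₜ[ℝ] P.m)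
          = (ρ₁ : ℂ) • ((1 : ℂ) ⊗ₜ[ℝ] P.m) + (ρ₂ : ℂ) • ((1 : ℂ) ⊗ₜ[ℝ] P.l) := by
        rw [LinearMap.baseChange_tmul, hm, TensorProduct.tmul_add, one_tmul_smul, one_tmul_smul]
      intro i j hj
      fin_cases i
      · change (mixed g hg R).baseChange ℂ ((1 : ℂ) ⊗ₜ[ℝ] P.m - Complex.I • ((1 : ℂ) ⊗ₜ[ℝ] P.l))
          = ((ρ₁ : ℂ) + ρ₂ * Complex.I) •
            ((1 : ℂ) ⊗ₜ[ℝ] P.m - Complex.I • ((1 : ℂ) ⊗ₜ[ℝ] P.l)) + _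
        have hj1 : j < 1 := hj
        rw [if_pos (by omega), map_sub, map_smul, hml, hmm]
        match_scalars
        · ring
        · linear_combination (ρ₂ : ℂ) * Complex.I_mul_I
      · change (mixed g hg R).baseChange ℂ ((1 : ℂ) ⊗ₜ[ℝ] P.m + Complex.I • ((1 : ℂ) ⊗ₜ[ℝ] P.l))
          = ((ρ₁ : ℂ) - ρ₂ * Complex.I) •
            ((1 : ℂ) ⊗ₜ[ℝ] P.m + Complex.I • ((1 : ℂ) ⊗ₜ[ℝ] P.l)) + _
        have hj1 : j < 1 := hj
        rw [if_pos (by omega), map_add, map_smul, hml, hmm]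
        match_scalars
        · ring
        · linear_combination (ρ₂ : ℂ) * Complex.I_mul_I
      all_goals obtain rfl : j = 0 := Nat.lt_one_iff.1 hj
      · exact baseChange_eigenvector hx rfl _
      · exact baseChange_eigenvector hy rfl _
      · exact baseChange_eigenvector hz rfl _

end SegreTypeOfCanonicalForm

end Segre5D

/-! ### Assembly of the classification -/

theorem mainTheorem2 {V : Type*} [AddCommGroup V] [Module ℝ V] [FiniteDimensional ℝ V]
    (g : LinearMap.BilinForm ℝ V) (hg : Segre5D.IsLorentzian g) :
    (∀ R : LinearMap.BilinForm ℝ V, R.IsSymm →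
      -- every symmetric two-tensor has exactly one Segre type
      (∃! s, Segre5D.HasSegreType g hg R s) ∧
      -- it is one of the four types or one of their degeneracies, for exactly one of the four
      (∀ s, Segre5D.HasSegreType g hg R s → ∃! F : Segre5D.SegreClass, s = F.symbol ∨ F.IsDegeneracy s) ∧
      -- the tensor has such a type if and only if it takes the corresponding canonical form
      (∀ (F : Segre5D.SegreClass) (s : Segre5D.SegreSymbol),
        (Segre5D.HasSegreType g hg R s ∧ (s = F.symbol ∨ F.IsDegeneracy s)) ↔
          Segre5D.HasCanonicalForm g R s F)) ∧
    -- all the four types and all their degeneracies occur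
    (∀ (F : Segre5D.SegreClass) (s : Segre5D.SegreSymbol), s = F.symbol ∨ F.IsDegeneracy s →
      ∃ R : LinearMap.BilinForm ℝ V, R.IsSymm ∧ Segre5D.HasSegreType g hg R s) ∧
    -- there are twenty-two degeneracies
    {s : Segre5D.SegreSymbol | ∃ F : Segre5D.SegreClass, F.IsDegeneracy s}.ncard = 22 := by
  open Segre5D in
  refine ⟨fun R hR => ?_, fun F s hs => ?_, ncard_degeneracies⟩
  · obtain ⟨F₀, s₀, h₀⟩ := exists_hasCanonicalForm hg hR
    have hs₀ := h₀.hasSegreType hg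
    refine ⟨⟨s₀, hs₀, fun s hs => hs.unique hs₀⟩, fun s hs => ?_, fun F s => ⟨?_, fun h => ?_⟩⟩
    · obtain rfl := hs.unique hs₀
      have hF₀ := SegreClass.attains_iff.1 h₀.attains
      exact ⟨F₀, hF₀, fun F hF => SegreClass.eq_of_reflTransGen
        (SegreClass.reflTransGen_iff.2 hF) (SegreClass.reflTransGen_iff.2 hF₀)⟩
    -- Some canonical form exists; uniqueness of the type and disjointness of the families identify
    -- it with the prescribed one.
    · rintro ⟨hs, hF⟩
      obtain rfl := hs.unique hs₀
      obtain rfl : F = F₀ := SegreClass.eq_of_reflTransGen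
        (SegreClass.reflTransGen_iff.2 hF) h₀.attains.reflTransGen
      exact h₀
    · exact ⟨h.hasSegreType hg, SegreClass.attains_iff.1 h.attains⟩
  · obtain ⟨P⟩ := hg.exists_pentad
    obtain ⟨R, hR⟩ := (SegreClass.attains_iff.2 hs).exists_form P
    exact ⟨R, hR.isSymm, hR.hasSegreType hg⟩
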